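/- All graphs are finite, simple and undirected. For a connected graph $G$ with vertices $v_1,\dots,v_n$, let $D(G)=(d_G(v_i,v_j))_{i,j}$ be its distance matrix, where $d_G$ is the length of a shortest path, and let the distance spectral radius $\rho(G)$ be the largest eigenvalue of $D(G)$. Let $K_4^{(n)}$ $(n\ge 4)$ be the kite graph of order $n$ obtained from the complete graph $K_4$ by attaching a path of length $n-4$ at one of its vertices. Three subgraphs $G_1,G_2,G_3$ of $G$ are said to form three cactus-type cycles in $G$ if they are pairwise edge-disjoint cycles and the subgraph of $G$ induced by the edge set $E(G_1)\cup E(G_2)\cup E(G_3)$ contains exactly three cycles. Lemma. If $G$ is a connected graph of order $n$ having three cactus-type cycles, then $$\rho(G)<\rho\bigl(K_4^{(n)}\bigr).$$ -/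

import Mathlib

namespace DistSpec

/-- The distance matrix of a graph, `D(G)_{uv} = d_G(u, v)`, with real entries. -/
noncomputable def distMatrix {V : Type*} (G : SimpleGraph V) : Matrix V V ℝ :=
  Matrix.of fun u v => (G.dist u v : ℝ)

/-- The distance spectral radius: the largest eigenvalue of the distance matrix.
The real spectrum of a real symmetric matrix over a nonempty finite index type is a nonempty
finite set, so the supremum is attained: see `isGreatest_distSpectralRadius`. -/
noncomputable def distSpectralRadius {V : Type*} [Fintype V] [DecidableEq V]
    (G : SimpleGraph V) : ℝ :=
  sSup (spectrum ℝ (distMatrix G))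

theorem isHermitian_distMatrix {V : Type*} (G : SimpleGraph V) :
    (distMatrix G).IsHermitian := by
  ext u v
  simp [distMatrix, SimpleGraph.dist_comm]

theorem isGreatest_distSpectralRadius {V : Type*} [Fintype V] [DecidableEq V] [Nonempty V]
    (G : SimpleGraph V) : IsGreatest (spectrum ℝ (distMatrix G)) (distSpectralRadius G) := by
  have h := (isHermitian_distMatrix G).spectrum_real_eq_range_eigenvalues
  have hfin : (spectrum ℝ (distMatrix G)).Finite := h ▸ Set.finite_range _
  have hne : (spectrum ℝ (distMatrix G)).Nonempty := h ▸ Set.range_nonempty _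
  exact ⟨hne.csSup_mem hfin, fun x hx => le_csSup hfin.bddAbove hx⟩

/-- The kite graph `K_k^{(n)}` on the vertices `0, …, n - 1` (for `1 ≤ k ≤ n`): the vertices
`0, …, k - 1` form a clique, and the path `k - 1, k, …, n - 1` of length `n - k` is attached to it
at the vertex `k - 1`. -/
def kite (k n : ℕ) : SimpleGraph (Fin n) where
  Adj i j := i ≠ j ∧
    ((i.val < k ∧ j.val < k) ∨ i.val + 1 = j.val ∨ j.val + 1 = i.val)
  symm := ⟨fun i j h => ⟨h.1.symm, by have := h.2; tauto⟩⟩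
  loopless := ⟨fun _ h => h.1 rfl⟩

/-- A subgraph is a cycle if it consists of the vertices and edges of a closed walk that
repeats no vertex (other than its endpoint) and no edge. -/
def IsCycleSubgraph {V : Type*} {G : SimpleGraph V} (C : G.Subgraph) : Prop :=
  ∃ (v : V) (p : G.Walk v v), p.IsCycle ∧ p.toSubgraph = C

/-- The edge-induced subgraph: its edges are the edges of `G` in `S`, and its vertices are
the end vertices of these edges. -/
def edgeInduced {V : Type*} (G : SimpleGraph V) (S : Set (Sym2 V)) : G.Subgraph where
  verts := {u | ∃ v, G.Adj u v ∧ s(u, v) ∈ S}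
  Adj u v := G.Adj u v ∧ s(u, v) ∈ S
  adj_sub h := h.1
  edge_vert {_ v} h := ⟨v, h⟩
  symm := ⟨fun u v h => ⟨h.1.symm, by rw [Sym2.eq_swap]; exact h.2⟩⟩

/-- `G₁`, `G₂`, `G₃` form three cactus-type cycles in `G`: they are pairwise edge-disjoint cycles,
and the subgraph induced by the union of their edge sets contains exactly three cycles. -/
def AreCactusTypeCycles {V : Type*} {G : SimpleGraph V} (G₁ G₂ G₃ : G.Subgraph) : Prop :=
  IsCycleSubgraph G₁ ∧ IsCycleSubgraph G₂ ∧ IsCycleSubgraph G₃ ∧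
  Disjoint G₁.edgeSet G₂.edgeSet ∧ Disjoint G₁.edgeSet G₃.edgeSet ∧
  Disjoint G₂.edgeSet G₃.edgeSet ∧
  {C : G.Subgraph | IsCycleSubgraph C ∧
    C ≤ edgeInduced G (G₁.edgeSet ∪ G₂.edgeSet ∪ G₃.edgeSet)}.encard = 3

end DistSpec

/-!
The distance matrix is nonnegative, so `ρ(G)` is attained at a positive vector `x`, and it is enough
to find for every positive `x` a bijection of the vertices of `G` onto those of the kite that
increases the quadratic form of the distance matrix at `x`.

Deleting edges increases distances, so we may assume that all edges outside the three cycles are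
bridges; then each cycle has a gate map, which sends a vertex to the vertex of the cycle at which it
hangs. Some cycle is an end cycle: both others hang at the same vertex `w` of it, and the set `X` of
the vertices that do not hang at `w` can be chosen with weight `P = x(X)` at most the weight that
lies beyond `w` with respect to either of the other cycles.

The pile of the vertices hanging at `w`, with the additional weight `P` placed on `w` to represent
`X`, is now straightened. Unfolding a cycle into a path costs nothing, and averaged over four
unfoldings it gains at least `P` times the weight of the pile; so the other two cycles together gain
twice this amount. The vertices of the resulting graph can then be ordered along a path without
loss. Finally `X` is put onto the end of the kite with the clique `K₄`, the pile onto its tail: the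
perimeters of the geodesic triangles with a corner at `w` are small enough that each vertex of `X`
loses at most as much in its distances to other vertices of `X` as it gains in its distances to the
pile, which weighs no less than `X`. This leaves a loss of one unit per pair in `X` times the pile,
which the two unfolded cycles pay for.
-/

namespace DistSpec

section Forms

variable {V W : Type*}

/-- The quadratic form of a kernel `k`, restricted to a finite set `s` of points. -/
noncomputable def kerForm (s : Finset V) (k : V → V → ℝ) (y : V → ℝ) : ℝ :=
  ∑ u ∈ s, ∑ v ∈ s, y u * y v * k u v

/-- The quadratic form of the distance matrix of `G`. -/
noncomputable def distForm [Fintype V] (G : SimpleGraph V) (x : V → ℝ) : ℝ :=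
  kerForm Finset.univ (fun u v => (G.dist u v : ℝ)) x

variable {s : Finset V} {k l : V → V → ℝ} {y : V → ℝ}

theorem kerForm_add : kerForm s (fun u v => k u v + l u v) y = kerForm s k y + kerForm s l y := by
  simp only [kerForm, mul_add, Finset.sum_add_distrib]

theorem kerForm_sub : kerForm s (fun u v => k u v - l u v) y = kerForm s k y - kerForm s l y := by
  simp only [kerForm, mul_sub, Finset.sum_sub_distrib]

theorem kerForm_const_mul (c : ℝ) : kerForm s (fun u v => c * k u v) y = c * kerForm s k y := by
  simp only [kerForm, Finset.mul_sum, mul_left_comm _ c]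

theorem kerForm_sum {ι : Type*} (I : Finset ι) (k : ι → V → V → ℝ) :
    kerForm s (fun u v => ∑ i ∈ I, k i u v) y = ∑ i ∈ I, kerForm s (k i) y := by
  simp only [kerForm, Finset.mul_sum, Finset.sum_comm (t := I)]

theorem kerForm_mono (hy : ∀ v ∈ s, 0 ≤ y v) (hkl : ∀ u ∈ s, ∀ v ∈ s, k u v ≤ l u v) :
    kerForm s k y ≤ kerForm s l y :=
  Finset.sum_le_sum fun u hu => Finset.sum_le_sum fun v hv =>
    mul_le_mul_of_nonneg_left (hkl u hu v hv) (mul_nonneg (hy u hu) (hy v hv))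

theorem kerForm_lt_kerForm (hy : ∀ v ∈ s, 0 < y v) (hkl : ∀ u ∈ s, ∀ v ∈ s, k u v ≤ l u v)
    (hlt : ∃ u ∈ s, ∃ v ∈ s, k u v < l u v) : kerForm s k y < kerForm s l y := by
  obtain ⟨u₀, hu₀, v₀, hv₀, hlt⟩ := hlt
  have entry_le {u v : V} (hu : u ∈ s) (hv : v ∈ s) : y u * y v * k u v ≤ y u * y v * l u v :=
    mul_le_mul_of_nonneg_left (hkl u hu v hv) (mul_pos (hy u hu) (hy v hv)).le
  exact Finset.sum_lt_sum (fun u hu => Finset.sum_le_sum fun v hv => entry_le hu hv)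
    ⟨u₀, hu₀, Finset.sum_lt_sum (fun v hv => entry_le hu₀ hv)
      ⟨v₀, hv₀, mul_lt_mul_of_pos_left hlt (mul_pos (hy u₀ hu₀) (hy v₀ hv₀))⟩⟩

theorem kerForm_congr (hkl : ∀ u ∈ s, ∀ v ∈ s, k u v = l u v) : kerForm s k y = kerForm s l y :=
  Finset.sum_congr rfl fun u hu => Finset.sum_congr rfl fun v hv => by rw [hkl u hu v hv]

theorem kerForm_comp [DecidableEq W] {t : Finset W} {f : V → W} (hf : ∀ v ∈ s, f v ∈ t)
    (k : W → W → ℝ) (y : V → ℝ) :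
    kerForm s (fun u v => k (f u) (f v)) y = kerForm t k fun z => ∑ v ∈ s with f v = z, y v := by
  have sum_fiber (g : W → ℝ) :
      ∑ v ∈ s, y v * g (f v) = ∑ z ∈ t, (∑ v ∈ s with f v = z, y v) * g z := by
    rw [← Finset.sum_fiberwise_of_maps_to hf]
    refine Finset.sum_congr rfl fun z _ => ?_
    rw [Finset.sum_mul]
    exact Finset.sum_congr rfl fun v hv => by rw [(Finset.mem_filter.1 hv).2]
  simp only [kerForm, mul_assoc, ← Finset.mul_sum]
  rw [← sum_fiber fun z => ∑ z' ∈ t, (∑ v ∈ s with f v = z', y v) * k z z']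
  exact Finset.sum_congr rfl fun u _ => by rw [← sum_fiber fun z => k (f u) z]

theorem kerForm_swap : kerForm s (fun u v => k v u) y = kerForm s k y := by
  simp only [kerForm]
  rw [Finset.sum_comm]
  simp only [mul_comm (y _) (y _)]

theorem kerForm_ite_and (s : Finset V) (p q : V → Prop) [DecidablePred p] [DecidablePred q]
    (y : V → ℝ) : kerForm s (fun u v => if p u ∧ q v then 1 else 0) y =
      (∑ u ∈ s with p u, y u) * ∑ v ∈ s with q v, y v := by
  have pointwise (u v : V) : y u * y v * (if p u ∧ q v then 1 else 0) =
      (if p u then y u else 0) * if q v then y v else 0 := by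
    split_ifs <;> simp_all
  simp only [kerForm, pointwise, ← Finset.mul_sum, ← Finset.sum_mul, ← Finset.sum_filter]

theorem kerForm_cut (s : Finset V) (p : V → Prop) [DecidablePred p] (y : V → ℝ) :
    kerForm s (fun u v => |(if p u then 1 else 0) - (if p v then 1 else 0)|) y =
      2 * (∑ v ∈ s with p v, y v) * ∑ v ∈ s with ¬ p v, y v := by
  have pointwise (u v : V) : |(if p u then (1 : ℝ) else 0) - (if p v then 1 else 0)| =
      (if p u ∧ ¬ p v then 1 else 0) + if ¬ p u ∧ p v then 1 else 0 := by
    split_ifs <;> simp_all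
  simp only [pointwise, kerForm_add, kerForm_ite_and]
  ring

end Forms

section Perron

variable {V : Type*} [Fintype V] (G : SimpleGraph V)

theorem dotProduct_distMatrix_mulVec (x : V → ℝ) :
    x ⬝ᵥ (distMatrix G).mulVec x = distForm G x := by
  simp only [dotProduct, Matrix.mulVec, distMatrix, Matrix.of_apply, distForm, kerForm,
    Finset.mul_sum]
  exact Finset.sum_congr rfl fun _ _ => Finset.sum_congr rfl fun _ _ => by ring

theorem distForm_le_distForm_abs (x : V → ℝ) : distForm G x ≤ distForm G fun v => |x v| :=
  Finset.sum_le_sum fun _ _ => Finset.sum_le_sum fun _ _ =>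
    mul_le_mul_of_nonneg_right ((le_abs_self _).trans_eq (abs_mul _ _)) (Nat.cast_nonneg _)

variable {G} in
theorem pos_of_distMatrix_mulVec_eq_smul (hG : G.Connected) {c : ℝ} {y : V → ℝ} (hy : 0 ≤ y)
    (hy0 : y ≠ 0) (hc : (distMatrix G).mulVec y = c • y) (v : V) : 0 < y v := by
  refine (hy v).lt_of_ne' fun hv => hy0 (funext fun w => ?_)
  by_cases hvw : v = w
  · exact hvw ▸ hv
  have row : ∑ u, (G.dist v u : ℝ) * y u = 0 := by
    simpa [Matrix.mulVec, dotProduct, distMatrix, hv] using congrFun hc v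
  have entry := (Finset.sum_eq_zero_iff_of_nonneg fun u _ =>
    mul_nonneg (Nat.cast_nonneg (G.dist v u)) (hy u)).1 row w (Finset.mem_univ w)
  exact (mul_eq_zero.1 entry).resolve_left
    (Nat.cast_ne_zero.2 (hG.pos_dist_of_ne hvw).ne')

variable [DecidableEq V]

theorem dotProduct_sub_mulVec (x : V → ℝ) :
    x ⬝ᵥ (distSpectralRadius G • (1 : Matrix V V ℝ) - distMatrix G).mulVec x =
      distSpectralRadius G * ∑ v, x v ^ 2 - distForm G x := by
  rw [Matrix.sub_mulVec, dotProduct_sub, dotProduct_distMatrix_mulVec, Matrix.smul_mulVec,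
    Matrix.one_mulVec, dotProduct_smul]
  simp [dotProduct, sq]

section

variable [Nonempty V]

theorem posSemidef_distSpectralRadius_sub :
    (distSpectralRadius G • (1 : Matrix V V ℝ) - distMatrix G).PosSemidef := by
  have hermitian : (distSpectralRadius G • (1 : Matrix V V ℝ) - distMatrix G).IsHermitian := by
    refine Matrix.IsHermitian.sub ?_ (isHermitian_distMatrix G)
    rw [Matrix.IsHermitian, Matrix.conjTranspose_smul, Matrix.conjTranspose_one, star_trivial]
  rw [hermitian.posSemidef_iff_eigenvalues_nonneg]
  intro i
  have mem := hermitian.eigenvalues_mem_spectrum_real i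
  generalize hermitian.eigenvalues i = ν at mem ⊢
  rw [← Algebra.algebraMap_eq_smul_one, ← spectrum.singleton_sub_eq] at mem
  obtain ⟨_, rfl, μ, hμ, rfl⟩ := Set.mem_sub.1 mem
  exact sub_nonneg.2 ((isGreatest_distSpectralRadius G).2 hμ)

theorem distForm_le (x : V → ℝ) : distForm G x ≤ distSpectralRadius G * ∑ v, x v ^ 2 := by
  have h := (posSemidef_distSpectralRadius_sub G).dotProduct_mulVec_nonneg x
  rwa [star_trivial, dotProduct_sub_mulVec, sub_nonneg] at h

variable {G} in
theorem mulVec_eq_of_distForm_eq {x : V → ℝ}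
    (hx : distForm G x = distSpectralRadius G * ∑ v, x v ^ 2) :
    (distMatrix G).mulVec x = distSpectralRadius G • x := by
  have h := (posSemidef_distSpectralRadius_sub G).dotProduct_mulVec_zero_iff x
  rw [star_trivial, dotProduct_sub_mulVec, hx, sub_self, Matrix.sub_mulVec, Matrix.smul_mulVec,
    Matrix.one_mulVec, sub_eq_zero] at h
  exact (h.1 rfl).symm

theorem exists_ne_zero_distForm_eq :
    ∃ x : V → ℝ, x ≠ 0 ∧ distForm G x = distSpectralRadius G * ∑ v, x v ^ 2 := by
  have h := (isGreatest_distSpectralRadius G).1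
  rw [(isHermitian_distMatrix G).spectrum_real_eq_range_eigenvalues] at h
  obtain ⟨i, hi⟩ := h
  refine ⟨⇑((isHermitian_distMatrix G).eigenvectorBasis i), fun h0 => ?_, ?_⟩
  · exact (isHermitian_distMatrix G).eigenvectorBasis.orthonormal.ne_zero i
      (by ext v; exact congrFun h0 v)
  · rw [← dotProduct_distMatrix_mulVec, (isHermitian_distMatrix G).mulVec_eigenvectorBasis i, hi,
      dotProduct_smul]
    simp [dotProduct, sq]

end

variable {G}

theorem exists_pos_distForm_eq (hG : G.Connected) :
    ∃ x : V → ℝ, (∀ v, 0 < x v) ∧ distForm G x = distSpectralRadius G * ∑ v, x v ^ 2 := by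
  have := hG.nonempty
  obtain ⟨x, hx0, hx⟩ := exists_ne_zero_distForm_eq G
  have eq_abs : distForm G (fun v => |x v|) = distSpectralRadius G * ∑ v, |x v| ^ 2 := by
    refine (distForm_le G _).antisymm ?_
    simpa only [sq_abs, ← hx] using distForm_le_distForm_abs G x
  refine ⟨fun v => |x v|, ?_, eq_abs⟩
  exact pos_of_distMatrix_mulVec_eq_smul hG (fun v => abs_nonneg (x v))
    (fun h => hx0 (funext fun v => abs_eq_zero.1 (congrFun h v))) (mulVec_eq_of_distForm_eq eq_abs)

theorem distSpectralRadius_lt_of_distForm_lt {W : Type*} [Fintype W] [DecidableEq W]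
    (hG : G.Connected) (K : SimpleGraph W)
    (h : ∀ x : V → ℝ, (∀ v, 0 < x v) →
      ∃ σ : V ≃ W, distForm G x < distForm K (x ∘ σ.symm)) :
    distSpectralRadius G < distSpectralRadius K := by
  have := hG.nonempty
  obtain ⟨x, hx, eq⟩ := exists_pos_distForm_eq hG
  obtain ⟨σ, hσ⟩ := h x hx
  have : Nonempty W := σ.nonempty_congr.1 ‹_›
  have norm_eq : ∑ w, (x ∘ σ.symm) w ^ 2 = ∑ v, x v ^ 2 :=
    Equiv.sum_comp σ.symm fun v => x v ^ 2
  have norm_pos : 0 < ∑ v, x v ^ 2 :=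
    Finset.sum_pos (fun v _ => pow_pos (hx v) 2) Finset.univ_nonempty
  refine lt_of_mul_lt_mul_right ?_ norm_pos.le
  calc distSpectralRadius G * ∑ v, x v ^ 2 = distForm G x := eq.symm
    _ < distForm K (x ∘ σ.symm) := hσ
    _ ≤ distSpectralRadius K * ∑ v, x v ^ 2 := norm_eq ▸ distForm_le K _

end Perron

section Graph

variable {V : Type*} {G : SimpleGraph V}

theorem reachable_of_forall_exists_adj_lt {r : V} (f : V → ℕ)
    (hf : ∀ z ≠ r, ∃ z', G.Adj z z' ∧ f z' < f z) (z : V) : G.Reachable z r := by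
  induction z using (measure f).wf.induction with
  | _ z ih =>
    by_cases hz : z = r
    · rw [hz]
    · obtain ⟨z', hadj, hlt⟩ := hf z hz
      exact hadj.reachable.trans (ih z' hlt)

theorem exists_adj_dist_lt (hG : G.Preconnected) {r z : V} (hz : z ≠ r) :
    ∃ z', G.Adj z z' ∧ G.dist r z' < G.dist r z := by
  obtain ⟨p, hp⟩ := (hG z r).exists_walk_length_eq_dist
  cases p with
  | nil => exact absurd rfl hz
  | cons hadj q =>
    refine ⟨_, hadj, ?_⟩
    rw [SimpleGraph.Walk.length_cons] at hp
    rw [G.dist_comm, G.dist_comm (u := r), ← hp]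
    exact Nat.lt_succ_of_le (G.dist_le q)

theorem dist_le_dist_add_one {u v : V} (h : G.Adj u v) (w : V) : G.dist u w ≤ G.dist v w + 1 := by
  rw [G.dist_comm (v := w), G.dist_comm (v := w)]
  have := h.symm.diff_dist_adj (u := w)
  omega

theorem le_add_length_of_forall_adj (f : V → ℕ) (hf : ∀ u v, G.Adj u v → f v ≤ f u + 1) {u v : V}
    (p : G.Walk u v) : f v ≤ f u + p.length := by
  induction p with
  | nil => simp
  | cons h p ih =>
    have := hf _ _ h
    rw [SimpleGraph.Walk.length_cons]
    omega

theorem le_add_dist_of_forall_adj (hG : G.Connected) (f : V → ℕ)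
    (hf : ∀ u v, G.Adj u v → f v ≤ f u + 1) (u v : V) : f v ≤ f u + G.dist u v := by
  obtain ⟨p, hp⟩ := hG.exists_walk_length_eq_dist u v
  exact hp ▸ le_add_length_of_forall_adj f hf p

theorem exists_adj_preconnected_erase [DecidableEq V] {s : Finset V}
    (hs : (G.induce (s : Set V)).Preconnected) {r : V} (hr : r ∈ s) (hcard : 1 < s.card) :
    ∃ v ∈ s, v ≠ r ∧ (∃ u ∈ s, u ≠ v ∧ G.Adj v u) ∧
      (G.induce ((s.erase v : Finset V) : Set V)).Preconnected := by
  let d (z : (s : Set V)) : ℕ := (G.induce (s : Set V)).dist ⟨r, hr⟩ z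
  have : Nonempty (s : Set V) := ⟨⟨r, hr⟩⟩
  obtain ⟨v, hmax⟩ := Finite.exists_max d
  have hvr : v ≠ ⟨r, hr⟩ := by
    rintro rfl
    obtain ⟨z, hz, hzr⟩ := Finset.exists_mem_ne hcard r
    have pos := (hs ⟨r, hr⟩ ⟨z, hz⟩).pos_dist_of_ne fun h => hzr (congrArg Subtype.val h).symm
    have := hmax ⟨z, hz⟩
    simp only [d, SimpleGraph.dist_self] at this
    omega
  obtain ⟨u, hvu, -⟩ := exists_adj_dist_lt hs hvr
  have hrv : r ∈ s.erase v := Finset.mem_erase.2 ⟨fun h => hvr (Subtype.ext h.symm), hr⟩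
  refine ⟨v, v.2, fun h => hvr (Subtype.ext h), ⟨u, u.2, fun h => hvu.ne' (Subtype.ext h), hvu⟩, ?_⟩
  have reach : ∀ z, (G.induce ((s.erase v : Finset V) : Set V)).Reachable z ⟨r, hrv⟩ := by
    refine reachable_of_forall_exists_adj_lt (fun z => d ⟨z, Finset.mem_of_mem_erase z.2⟩) ?_
    rintro ⟨z, hz⟩ hzr
    obtain ⟨z', hadj, hlt⟩ :=
      exists_adj_dist_lt hs (r := ⟨r, hr⟩) (z := ⟨z, Finset.mem_of_mem_erase hz⟩)
        fun h => hzr (Subtype.ext (Subtype.mk.inj h))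
    have hz' : z' ≠ v := fun h => (hmax ⟨z, Finset.mem_of_mem_erase hz⟩).not_gt (h ▸ hlt)
    exact ⟨⟨z', Finset.mem_erase.2 ⟨fun h => hz' (Subtype.ext h), z'.2⟩⟩, hadj, hlt⟩
  exact fun a b => (reach a).trans (reach b).symm

end Graph

section Numbering

variable {V : Type*} {s : Finset V} {t : V → ℕ}

/-- `t` numbers the points of `s` by `0, …, s.card - 1`; its values outside `s` are arbitrary. -/
structure IsNumbering (s : Finset V) (t : V → ℕ) : Prop where
  lt : ∀ v ∈ s, t v < s.card
  injOn : Set.InjOn t s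

namespace IsNumbering

theorem reflect (ht : IsNumbering s t) : IsNumbering s fun v => s.card - 1 - t v where
  lt v hv := by have := ht.lt v hv; omega
  injOn u hu v hv h := by
    have := ht.lt u hu
    have := ht.lt v hv
    exact ht.injOn hu hv (by dsimp only at h; omega)

theorem cast_reflect (ht : IsNumbering s t) {v : V} (hv : v ∈ s) :
    ((s.card - 1 - t v : ℕ) : ℝ) = s.card - 1 - t v := by
  have := ht.lt v hv
  rw [Nat.cast_sub (by omega), Nat.cast_sub (by omega), Nat.cast_one]

theorem kerForm_reflect (ht : IsNumbering s t) (y : V → ℝ) :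
    kerForm s (fun u v => |((s.card - 1 - t u : ℕ) : ℝ) - (s.card - 1 - t v : ℕ)|) y =
      kerForm s (fun u v => |(t u : ℝ) - t v|) y :=
  kerForm_congr fun u hu v hv => by
    rw [ht.cast_reflect hu, ht.cast_reflect hv, sub_sub_sub_cancel_left, abs_sub_comm]

theorem exists_eq (ht : IsNumbering s t) {k : ℕ} (hk : k < s.card) : ∃ v ∈ s, t v = k := by
  have surj : Set.SurjOn t s (Finset.range s.card) :=
    Finset.surjOn_of_injOn_of_card_le t
      (fun v hv => Finset.mem_coe.2 (Finset.mem_range.2 (ht.lt v hv))) ht.injOn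
      (Finset.card_range _).le
  exact surj (Finset.mem_coe.2 (Finset.mem_range.2 hk))

end IsNumbering

variable [DecidableEq V]

/-- The numbering obtained from `t` by inserting a new point `v` right after `u`. -/
def insertAfter (t : V → ℕ) (u v z : V) : ℕ :=
  t (if z = v then u else z) + if z = v ∨ t u < t z then 1 else 0

theorem IsNumbering.insertAfter {u v : V} (ht : IsNumbering s t) (hu : u ∈ s) (hv : v ∉ s) :
    IsNumbering (insert v s) (insertAfter t u v) where
  lt z hz := by
    have := ht.lt u hu
    rw [Finset.card_insert_of_notMem hv, DistSpec.insertAfter]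
    by_cases hzv : z = v
    · simp only [hzv, if_true, true_or]
      omega
    · have := ht.lt z (Finset.mem_of_mem_insert_of_ne hz hzv)
      split_ifs <;> omega
  injOn a ha b hb h := by
    have mem {z : V} (hz : z ∈ (insert v s : Finset V)) (hzv : z ≠ v) : z ∈ s :=
      Finset.mem_of_mem_insert_of_ne hz hzv
    simp only [DistSpec.insertAfter] at h
    by_cases hav : a = v <;> by_cases hbv : b = v <;>
      simp only [hav, hbv, if_true, if_false, true_or, false_or] at h ⊢
    · split_ifs at h <;> omega
    · split_ifs at h <;> omega
    · exact ht.injOn (mem ha hav) (mem hb hbv) (by split_ifs at h <;> omega)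

theorem abs_insertAfter_sub (t : V → ℕ) (u v a b : V) :
    |(insertAfter t u v a : ℝ) - insertAfter t u v b| =
      |(t (if a = v then u else a) : ℝ) - t (if b = v then u else b)| +
        |(if a = v ∨ t u < t a then (1 : ℝ) else 0) - if b = v ∨ t u < t b then 1 else 0| := by
  simp only [insertAfter, Nat.cast_add, Nat.cast_ite, Nat.cast_one, Nat.cast_zero]
  rw [add_sub_add_comm, abs_add_eq_add_abs_iff]
  simp only [sub_nonneg, sub_nonpos, Nat.cast_le]
  split_ifs <;> norm_num <;> grind

end Numbering

section PathOrder

variable {V : Type*} {G : SimpleGraph V} {s : Finset V} {y : V → ℝ}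

theorem kerForm_insert_le_insertAfter [DecidableEq V] {t : V → ℕ} {u v r : V} (hu : u ∈ s)
    (hv : v ∉ s) (hvu : G.Adj v u) (hr : r ∈ s) (hru : t r ≤ t u) (hvr : y v ≤ y r)
    (hy : ∀ z, 0 ≤ y z)
    (hle : kerForm s (fun a b => (G.dist a b : ℝ))
        (fun z => ∑ a ∈ insert v s with (if a = v then u else a) = z, y a) ≤
      kerForm s (fun a b => |(t a : ℝ) - t b|)
        fun z => ∑ a ∈ insert v s with (if a = v then u else a) = z, y a) :
    kerForm (insert v s) (fun a b => (G.dist a b : ℝ)) y ≤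
      kerForm (insert v s) (fun a b => |(insertAfter t u v a : ℝ) - insertAfter t u v b|) y := by
  let after (z : V) : Prop := z = v ∨ t u < t z
  let merge (z : V) : V := if z = v then u else z
  have merge_mem : ∀ z ∈ insert v s, merge z ∈ s := fun z hz => by
    by_cases h : z = v
    · simp [merge, h, hu]
    · simpa [merge, h] using hz
  have dist_le : kerForm (insert v s) (fun a b => (G.dist a b : ℝ)) y ≤
      kerForm (insert v s) (fun a b => (G.dist (merge a) (merge b) : ℝ)) y +
        kerForm (insert v s)
          (fun a b => |(if a = v then (1 : ℝ) else 0) - if b = v then 1 else 0|) y := by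
    rw [← kerForm_add]
    refine kerForm_mono (fun z _ => hy z) fun a _ b _ => ?_
    have hle (z : V) : (G.dist v z : ℝ) ≤ G.dist u z + 1 := by
      exact_mod_cast dist_le_dist_add_one hvu z
    by_cases ha : a = v <;> by_cases hb : b = v <;> simp [merge, ha, hb, hle]
    simpa only [G.dist_comm] using hle a
  rw [kerForm_comp merge_mem (fun a b => (G.dist a b : ℝ)),
    kerForm_cut _ (fun z => z = v)] at dist_le
  -- `v` lies after the new cut and the heavier point `r` before it, so neither side of this cut
  -- weighs less than `v`.
  have cut_le : (∑ z ∈ insert v s with z = v, y z) * ∑ z ∈ insert v s with ¬ z = v, y z ≤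
      (∑ z ∈ insert v s with after z, y z) * ∑ z ∈ insert v s with ¬ after z, y z := by
    have hsum := (Finset.sum_filter_add_sum_filter_not (insert v s) (fun z => z = v) y).trans
      (Finset.sum_filter_add_sum_filter_not (insert v s) after y).symm
    have hv_le : y v ≤ ∑ z ∈ insert v s with after z, y z :=
      Finset.single_le_sum (fun z _ => hy z) (by simp [after])
    have hr_le : y r ≤ ∑ z ∈ insert v s with ¬ after z, y z :=
      Finset.single_le_sum (fun z _ => hy z) (by
        simp [after, hr, hru, (ne_of_mem_of_not_mem hr hv)])
    have hsingle : ∑ z ∈ insert v s with z = v, y z = y v := by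
      simp [Finset.filter_eq']
    rw [hsingle] at hsum ⊢
    rw [← eq_sub_iff_add_eq'] at hsum
    rw [hsum]
    linarith [mul_nonneg (sub_nonneg.2 hv_le) (sub_nonneg.2 (hvr.trans hr_le))]
  simp only [abs_insertAfter_sub]
  rw [kerForm_add, kerForm_comp merge_mem (fun a b => |(t a : ℝ) - t b|), kerForm_cut _ after]
  linarith

theorem exists_isNumbering_kerForm_dist_le
    (hs : (G.induce (s : Set V)).Preconnected) (hy : ∀ v, 0 ≤ y v) :
    ∃ t, IsNumbering s t ∧ kerForm s (fun a b => (G.dist a b : ℝ)) y ≤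
      kerForm s (fun a b => |(t a : ℝ) - t b|) y := by
  classical
  induction s using Finset.strongInduction generalizing y with
  | _ s ih =>
    rcases le_or_gt s.card 1 with hcard | hcard
    · have heq := Finset.card_le_one.1 hcard
      refine ⟨fun _ => 0, ⟨fun v hv => Finset.card_pos.2 ⟨v, hv⟩, fun a ha b hb _ => heq a ha b hb⟩,
        (kerForm_congr fun a ha b hb => ?_).le⟩
      simp [heq a ha b hb]
    obtain ⟨r, hr, hmax⟩ := s.exists_max_image y (Finset.card_pos.1 (by omega))
    obtain ⟨v, hv, hvr, ⟨u, hu, huv, hvu⟩, hconn⟩ := exists_adj_preconnected_erase hs hr hcard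
    obtain ⟨t, ht, hle, hru⟩ : ∃ t, IsNumbering (s.erase v) t ∧
        kerForm (s.erase v) (fun a b => (G.dist a b : ℝ))
            (fun z => ∑ a ∈ s with (if a = v then u else a) = z, y a) ≤
          kerForm (s.erase v) (fun a b => |(t a : ℝ) - t b|)
            (fun z => ∑ a ∈ s with (if a = v then u else a) = z, y a) ∧
        t r ≤ t u := by
      obtain ⟨t, ht, hle⟩ := ih _ (Finset.erase_ssubset hv) hconn
        (y := fun z => ∑ a ∈ s with (if a = v then u else a) = z, y a)
        fun z => Finset.sum_nonneg fun a _ => hy a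
      rcases le_total (t r) (t u) with hru | hru
      · exact ⟨t, ht, hle, hru⟩
      · exact ⟨_, ht.reflect, by rwa [ht.kerForm_reflect], by omega⟩
    have hvs : v ∉ s.erase v := Finset.notMem_erase v s
    have hus : u ∈ s.erase v := Finset.mem_erase.2 ⟨huv, hu⟩
    refine ⟨insertAfter t u v, ?_, ?_⟩
    · simpa only [Finset.insert_erase hv] using ht.insertAfter hus hvs
    · have := kerForm_insert_le_insertAfter hus hvs hvu (Finset.mem_erase.2 ⟨hvr.symm, hr⟩) hru
        (hmax v hv) hy (by rwa [Finset.insert_erase hv])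
      rwa [Finset.insert_erase hv] at this

end PathOrder

section Unfolding

/-- Four ways to arrange the vertices of a cycle of length `ℓ` on a path that starts at the
vertex `0`: in order, in reverse order, and the two variants of these in which the last vertex is
moved next to the vertex `0`. -/
def unfoldPos (ℓ : ℕ) : Fin 4 → ℕ → ℕ
  | 0, i => i
  | 1, i => if i = 0 then 0 else ℓ - i
  | 2, i => if i = 0 then 0 else if i = 1 then 1 else ℓ - i + 1
  | 3, i => if i = 0 then 0 else if i + 1 = ℓ then 1 else i + 1

/-- The distance between the `i`-th and the `j`-th vertex of a cycle of length `ℓ`, for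
`i, j < ℓ`. -/
def cycleDist (ℓ i j : ℕ) : ℤ :=
  min |(i : ℤ) - j| (ℓ - |(i : ℤ) - j|)

/-- Half of a lower bound for the total gain in the distance between the `i`-th and the `j`-th
vertex of a cycle of length `ℓ` over the four arrangements `unfoldPos ℓ`; the total is
`unfoldGain ℓ i j + unfoldGain ℓ j i`. -/
def unfoldGain (ℓ i j : ℕ) : ℤ :=
  (if i = 0 ∧ j ≠ 0 then 1 else 0) + (if i = 0 ∧ j ≠ 0 then 1 else 0) +
    (if i = 0 ∧ 2 * j = ℓ + 2 then 1 else 0) + (if i = 0 ∧ 2 * j + 2 = ℓ then 1 else 0) -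
    (if i = 1 ∧ 2 * j = ℓ + 2 then 1 else 0) - (if i = ℓ - 1 ∧ 2 * j + 2 = ℓ then 1 else 0)

theorem isNumbering_unfoldPos {ℓ : ℕ} (hℓ : 3 ≤ ℓ) (q : Fin 4) :
    IsNumbering (Finset.range ℓ) (unfoldPos ℓ q) where
  lt i hi := by
    rw [Finset.card_range]
    rw [Finset.mem_range] at hi
    fin_cases q <;> simp only [unfoldPos] <;> (try split_ifs) <;> omega
  injOn i hi j hj h := by
    simp only [Finset.coe_range, Set.mem_Iio] at hi hj
    fin_cases q <;> simp only [unfoldPos] at h <;> (try split_ifs at h) <;> omega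

theorem cycleDist_add_unfoldGain_le {ℓ i j : ℕ} (hℓ : 3 ≤ ℓ) (hi : i < ℓ) (hj : j < ℓ) :
    4 * cycleDist ℓ i j + unfoldGain ℓ i j + unfoldGain ℓ j i ≤
      ∑ q, |(unfoldPos ℓ q i : ℤ) - unfoldPos ℓ q j| := by
  rcases eq_or_ne i j with rfl | hne
  · simp only [cycleDist, unfoldGain, sub_self, abs_zero, Finset.sum_const_zero]
    grind
  wlog hij : i < j generalizing i j
  · have := this hj hi hne.symm (by omega)
    simp only [cycleDist, abs_sub_comm (i : ℤ), abs_sub_comm (unfoldPos ℓ _ i : ℤ)] at this ⊢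
    linarith
  simp only [Fin.sum_univ_four, unfoldPos, unfoldGain, cycleDist, Int.abs_eq_natAbs,
    Nat.cast_ite, Nat.cast_zero, Nat.cast_one, show ¬ j = 0 by omega, show ¬ i = ℓ - 1 by omega,
    false_and, if_false]
  obtain rfl | rfl | hi' : i = 0 ∨ i = 1 ∨ 2 ≤ i := by omega
  · simp only [if_true, true_and]
    split_ifs <;> omega
  · simp only [if_true, true_and, one_ne_zero, show ¬ j = 1 by omega, false_and, if_false]
    split_ifs <;> omega
  · simp only [show ¬ i = 0 by omega, show ¬ i = 1 by omega, show ¬ j = 1 by omega, false_and,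
      if_false]
    split_ifs <;> omega

end Unfolding

section GatedCycle

variable {V : Type*} {G : SimpleGraph V} {ℓ : ℕ} {r : ℕ → V} {γ : V → V}

/-- The sequence `r` runs through a cycle of length `ℓ` of `G` periodically. -/
structure IndexedCycle (G : SimpleGraph V) (ℓ : ℕ) (r : ℕ → V) : Prop where
  three_le : 3 ≤ ℓ
  eq_iff : ∀ i j, r i = r j ↔ i % ℓ = j % ℓ
  adj : ∀ j, G.Adj (r j) (r (j + 1))

/-- The edges of the cycle that `r` runs through. -/
def cycleEdges (r : ℕ → V) : Set (Sym2 V) :=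
  Set.range fun j => s(r j, r (j + 1))

/-- A cycle in `G` together with the map `γ` that sends every vertex to the vertex of the cycle at
which it hangs: the edges of `G` outside the cycle join vertices hanging at the same vertex. -/
structure GatedCycle (G : SimpleGraph V) (ℓ : ℕ) (r : ℕ → V) (γ : V → V) : Prop
    extends IndexedCycle G ℓ r where
  gate_mem : ∀ u, γ u ∈ Set.range r
  gate_self : ∀ j, γ (r j) = r j
  edge : ∀ u v, G.Adj u v → γ u = γ v ∨ s(u, v) ∈ cycleEdges r

namespace IndexedCycle

theorem pos (h : IndexedCycle G ℓ r) : 0 < ℓ :=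
  zero_lt_three.trans_le h.three_le

theorem injOn (h : IndexedCycle G ℓ r) : Set.InjOn r (Set.Iio ℓ) := fun i hi j hj hij => by
  simpa only [Nat.mod_eq_of_lt hi, Nat.mod_eq_of_lt hj] using (h.eq_iff i j).1 hij

theorem add_mul (h : IndexedCycle G ℓ r) (j k : ℕ) : r (j + ℓ * k) = r j :=
  (h.eq_iff _ _).2 (Nat.add_mul_mod_self_left j ℓ k)

theorem exists_add_eq (h : IndexedCycle G ℓ r) (j k : ℕ) : ∃ i, i + k = j + ℓ * k :=
  ⟨j + ℓ * k - k, Nat.sub_add_cancel (by have := Nat.le_mul_of_pos_left k h.pos; omega)⟩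

theorem exists_lt_of_mem_range (h : IndexedCycle G ℓ r) {u : V} (hu : u ∈ Set.range r) :
    ∃ j < ℓ, r j = u := by
  obtain ⟨j, rfl⟩ := hu
  exact ⟨j % ℓ, Nat.mod_lt _ h.pos, (h.eq_iff _ _).2 (Nat.mod_mod _ _)⟩

theorem range_add (h : IndexedCycle G ℓ r) (k : ℕ) :
    Set.range (fun j => r (j + k)) = Set.range r := by
  refine (Set.range_comp_subset_range (· + k) r).antisymm ?_
  rintro _ ⟨j, rfl⟩
  obtain ⟨i, hi⟩ := h.exists_add_eq j k
  exact ⟨i, (congrArg r hi).trans (h.add_mul j k)⟩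

theorem cycleEdges_add (h : IndexedCycle G ℓ r) (k : ℕ) :
    cycleEdges (fun j => r (j + k)) = cycleEdges r := by
  refine Set.Subset.antisymm ?_ ?_
  · rintro _ ⟨j, rfl⟩
    exact ⟨j + k, by simp only [Nat.add_right_comm j k 1]⟩
  · rintro _ ⟨j, rfl⟩
    obtain ⟨i, hi⟩ := h.exists_add_eq j k
    refine ⟨i, ?_⟩
    simp only [Nat.add_right_comm i 1 k, hi, Nat.add_right_comm j (ℓ * k) 1, h.add_mul]

theorem rotate (h : IndexedCycle G ℓ r) (k : ℕ) : IndexedCycle G ℓ fun j => r (j + k) where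
  three_le := h.three_le
  eq_iff i j := (h.eq_iff _ _).trans
    ⟨fun e => Nat.ModEq.add_right_cancel' k e, fun e => Nat.ModEq.add_right k e⟩
  adj j := by simpa only [Nat.add_right_comm] using h.adj (j + k)

theorem dist_add_le (h : IndexedCycle G ℓ r) (i k : ℕ) : G.dist (r i) (r (i + k)) ≤ k := by
  induction k with
  | zero => simp
  | succ k ih =>
    have := dist_le_dist_add_one (h.adj (i + k)).symm (r i)
    rw [G.dist_comm, ← add_assoc]
    rw [G.dist_comm] at ih
    omega

theorem dist_le (h : IndexedCycle G ℓ r) {i j : ℕ} (hi : i < ℓ) (hj : j < ℓ) :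
    (G.dist (r i) (r j) : ℤ) ≤ cycleDist ℓ i j := by
  wlog hij : i ≤ j generalizing i j
  · rw [G.dist_comm, cycleDist, abs_sub_comm]
    exact this hj hi (by omega)
  have forward := h.dist_add_le i (j - i)
  have backward := h.dist_add_le j (i + ℓ - j)
  rw [show i + (j - i) = j by omega] at forward
  rw [show j + (i + ℓ - j) = i + ℓ * 1 by omega, h.add_mul, G.dist_comm] at backward
  rw [cycleDist, abs_sub_comm, abs_of_nonneg (by omega)]
  omega

end IndexedCycle

namespace GatedCycle

theorem rotate (h : GatedCycle G ℓ r γ) (k : ℕ) : GatedCycle G ℓ (fun j => r (j + k)) γ where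
  toIndexedCycle := h.toIndexedCycle.rotate k
  gate_mem u := h.range_add k ▸ h.gate_mem u
  gate_self j := h.gate_self (j + k)
  edge u v huv := h.cycleEdges_add k ▸ h.edge u v huv

theorem edge_gate (h : GatedCycle G ℓ r γ) {u v : V} (huv : G.Adj u v) :
    γ u = γ v ∨ γ u = u ∧ γ v = v := by
  refine (h.edge u v huv).imp id ?_
  rintro ⟨j, hj⟩
  rcases Sym2.eq_iff.1 hj with ⟨rfl, rfl⟩ | ⟨rfl, rfl⟩ <;> exact ⟨h.gate_self _, h.gate_self _⟩

theorem gate_gate (h : GatedCycle G ℓ r γ) (u : V) : γ (γ u) = γ u := by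
  obtain ⟨j, hj⟩ := h.gate_mem u
  rw [← hj, h.gate_self]

theorem exists_parent (h : GatedCycle G ℓ r γ) (hG : G.Preconnected) {u : V} (hu : γ u ≠ u) :
    ∃ z, G.Adj u z ∧ γ z = γ u ∧ G.dist (γ u) z < G.dist (γ u) u := by
  obtain ⟨z, hz, hlt⟩ := exists_adj_dist_lt hG hu.symm
  exact ⟨z, hz, ((h.edge_gate hz).resolve_right fun e => hu e.1).symm, hlt⟩

end GatedCycle

/-- The index `j < ℓ` with `γ u = r j`. -/
noncomputable def gateIndex (r : ℕ → V) (γ : V → V) (u : V) : ℕ :=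
  sInf {j | r j = γ u}

namespace GatedCycle

theorem apply_gateIndex (h : GatedCycle G ℓ r γ) (u : V) : r (gateIndex r γ u) = γ u :=
  Nat.sInf_mem (s := {j | r j = γ u}) (h.gate_mem u)

theorem gateIndex_lt (h : GatedCycle G ℓ r γ) (u : V) : gateIndex r γ u < ℓ := by
  obtain ⟨j, hj, hju⟩ := h.exists_lt_of_mem_range (h.gate_mem u)
  exact (Nat.sInf_le (s := {j | r j = γ u}) hju).trans_lt hj

theorem gateIndex_eq_iff (h : GatedCycle G ℓ r γ) {u : V} {j : ℕ} (hj : j < ℓ) :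
    gateIndex r γ u = j ↔ γ u = r j := by
  rw [← h.apply_gateIndex]
  exact ⟨congrArg r, fun e => h.injOn (h.gateIndex_lt u) hj e⟩

theorem gateIndex_apply (h : GatedCycle G ℓ r γ) {j : ℕ} (hj : j < ℓ) :
    gateIndex r γ (r j) = j :=
  (h.gateIndex_eq_iff hj).2 (h.gate_self j)

end GatedCycle

theorem gateIndex_congr {u v : V} (h : γ u = γ v) : gateIndex r γ u = gateIndex r γ v := by
  rw [gateIndex, gateIndex, h]

/-- The graph obtained from `G` by replacing a gated cycle by a path, on which the vertices of the
cycle stand in the order of `p`. -/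
def unfoldCycle (G : SimpleGraph V) (γ : V → V) (p : V → ℕ) : SimpleGraph V where
  Adj u v := G.Adj u v ∧ γ u = γ v ∨ γ u = u ∧ γ v = v ∧ (p u + 1 = p v ∨ p v + 1 = p u)
  symm := ⟨by
    rintro u v (⟨hadj, hγ⟩ | ⟨hu, hv, hp⟩)
    · exact Or.inl ⟨hadj.symm, hγ.symm⟩
    · exact Or.inr ⟨hv, hu, hp.symm⟩⟩
  loopless := ⟨by
    rintro u (⟨hadj, -⟩ | ⟨-, -, hp⟩)
    · exact hadj.ne rfl
    · omega⟩

theorem unfoldCycle_connected (h : GatedCycle G ℓ r γ) (hG : G.Preconnected) {f : ℕ → ℕ}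
    (hf : IsNumbering (Finset.range ℓ) f) :
    (unfoldCycle G γ fun u => f (gateIndex r γ u)).Connected := by
  have exists_lt {k : ℕ} (hk : k < ℓ) : ∃ i < ℓ, f i = k := by
    simpa only [Finset.mem_range] using hf.exists_eq (k := k) (by rwa [Finset.card_range])
  obtain ⟨i₀, hi₀, hfi₀⟩ := exists_lt h.pos
  have reach := reachable_of_forall_exists_adj_lt (r := r i₀)
    (G := unfoldCycle G γ fun u => f (gateIndex r γ u))
    (fun z => f (gateIndex r γ z) + G.dist (γ z) z) fun z hz => by
      by_cases hγz : γ z = z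
      · have pos : f (gateIndex r γ z) ≠ 0 := fun h0 => hz <| by
          rw [← hγz, ← h.apply_gateIndex]
          exact congrArg r (hf.injOn (by simpa using h.gateIndex_lt z) (by simpa using hi₀)
            (h0.trans hfi₀.symm))
        have hlt := hf.lt _ (Finset.mem_range.2 (h.gateIndex_lt z))
        rw [Finset.card_range] at hlt
        obtain ⟨i, hi, hfi⟩ := exists_lt (k := f (gateIndex r γ z) - 1) (by omega)
        refine ⟨r i, Or.inr ⟨hγz, h.gate_self i, Or.inr ?_⟩, ?_⟩ <;>
          simp only [h.gateIndex_apply hi, h.gate_self, SimpleGraph.dist_self] <;> omega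
      · obtain ⟨z', hadj, hγ, hlt⟩ := h.exists_parent hG hγz
        refine ⟨z', Or.inl ⟨hadj, hγ.symm⟩, ?_⟩
        simp only [gateIndex_congr (r := r) hγ, hγ]
        omega
  have : Nonempty V := ⟨r 0⟩
  exact ⟨fun u v => (reach u).trans (reach v).symm⟩

open Classical in
theorem le_dist_unfoldCycle {p : V → ℕ} (hp : ∀ u v, γ u = γ v → p u = p v)
    (hU : (unfoldCycle G γ p).Connected) (u v : V) :
    (if γ u = γ v then G.dist u v else
      G.dist u (γ u) + ((p u : ℤ) - p v).natAbs + G.dist (γ v) v) ≤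
      (unfoldCycle G γ p).dist u v := by
  let D (v : V) : ℕ := if γ u = γ v then G.dist u v else
    G.dist u (γ u) + ((p u : ℤ) - p v).natAbs + G.dist (γ v) v
  have lipschitz : ∀ v v', (unfoldCycle G γ p).Adj v v' → D v' ≤ D v + 1 := by
    rintro v v' (⟨hadj, hvv'⟩ | ⟨hv, hv', hpv⟩)
    · have dist_le (w : V) : G.dist w v' ≤ G.dist w v + 1 := by
        rw [G.dist_comm, G.dist_comm (u := w)]
        exact dist_le_dist_add_one hadj.symm w
      have := dist_le u
      have := dist_le (γ v)
      simp only [D, ← hvv', ← hp v v' hvv']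
      split_ifs <;> omega
    · have (e : γ u = v) : p u = p v := hp u v (e.trans hv.symm)
      have (e : γ u = v') : p u = p v' := hp u v' (e.trans hv'.symm)
      simp only [D, hv, hv', SimpleGraph.dist_self]
      split_ifs with e e' <;> grind
  simpa [D] using le_add_dist_of_forall_adj hU D lipschitz u v

theorem GatedCycle.dist_add_le_dist_unfoldCycle (h : GatedCycle G ℓ r γ) (hG : G.Connected)
    {f : ℕ → ℕ} (hf : IsNumbering (Finset.range ℓ) f) (u v : V) :
    (G.dist u v : ℤ) + (|(f (gateIndex r γ u) : ℤ) - f (gateIndex r γ v)| -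
        cycleDist ℓ (gateIndex r γ u) (gateIndex r γ v)) ≤
      (unfoldCycle G γ fun u => f (gateIndex r γ u)).dist u v := by
  have hle := le_dist_unfoldCycle (p := fun u => f (gateIndex r γ u))
    (fun u v e => by rw [gateIndex_congr e])
    (unfoldCycle_connected h hG.preconnected hf) u v
  split_ifs at hle with e
  · have hpos := h.pos
    rw [gateIndex_congr e, cycleDist, sub_self, sub_self, abs_zero]
    omega
  · have hcycle := h.dist_le (h.gateIndex_lt u) (h.gateIndex_lt v)
    rw [h.apply_gateIndex, h.apply_gateIndex] at hcycle
    have := hG.dist_triangle (u := u) (v := γ u) (w := v)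
    have := hG.dist_triangle (u := γ u) (v := γ v) (w := v)
    rw [Int.abs_eq_natAbs]
    omega

theorem GatedCycle.unfoldCycle {ℓ' : ℕ} {r' : ℕ → V} {γ' : V → V} (h' : GatedCycle G ℓ' r' γ')
    (hγ : ∀ i, γ (r' i) = γ (r' 0)) (hγ' : ∀ u v, γ u = u → γ v = v → γ' u = γ' v) (p : V → ℕ) :
    GatedCycle (unfoldCycle G γ p) ℓ' r' γ' where
  three_le := h'.three_le
  eq_iff := h'.eq_iff
  adj j := Or.inl ⟨h'.adj j, (hγ j).trans (hγ (j + 1)).symm⟩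
  gate_mem := h'.gate_mem
  gate_self := h'.gate_self
  edge u v huv := huv.elim (fun e => h'.edge u v e.1) fun e => Or.inl (hγ' u v e.1 e.2.1)

end GatedCycle

section Gain

variable {V : Type*} [Fintype V] {G : SimpleGraph V} {ℓ : ℕ} {r : ℕ → V} {γ : V → V} {y : V → ℝ}

theorem two_mul_mul_le_kerForm_unfoldGain {p : V → ℕ} (hy : ∀ v, 0 ≤ y v)
    (hmax : ∀ j, ∑ u with p u = j, y u ≤ ∑ u with p u = 0, y u) :
    2 * ((∑ u with p u = 0, y u) * ∑ u with p u ≠ 0, y u) ≤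
      kerForm Finset.univ (fun u v => (unfoldGain ℓ (p u) (p v) : ℝ)) y := by
  have le (j k : ℕ) := mul_le_mul_of_nonneg_right (hmax j)
    (Finset.sum_nonneg fun u (_ : u ∈ Finset.univ.filter fun u => 2 * p u + k = ℓ) => hy u)
  have le' (j k : ℕ) := mul_le_mul_of_nonneg_right (hmax j)
    (Finset.sum_nonneg fun u (_ : u ∈ Finset.univ.filter fun u => 2 * p u = ℓ + k) => hy u)
  simp only [unfoldGain, Int.cast_sub, Int.cast_add, Int.cast_ite, Int.cast_one, Int.cast_zero,
    kerForm_sub, kerForm_add]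
  rw [kerForm_ite_and _ (fun u => p u = 0) fun u => p u ≠ 0,
    kerForm_ite_and _ (fun u => p u = 0) fun u => 2 * p u = ℓ + 2,
    kerForm_ite_and _ (fun u => p u = 0) fun u => 2 * p u + 2 = ℓ,
    kerForm_ite_and _ (fun u => p u = 1) fun u => 2 * p u = ℓ + 2,
    kerForm_ite_and _ (fun u => p u = ℓ - 1) fun u => 2 * p u + 2 = ℓ]
  linarith [le (ℓ - 1) 2, le' 1 2]

variable [DecidableEq V]

namespace GatedCycle

theorem exists_unfold_of_forall_le (h : GatedCycle G ℓ r γ) (hG : G.Connected)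
    (hy : ∀ v, 0 ≤ y v) (hmax : ∀ j, ∑ u with γ u = r j, y u ≤ ∑ u with γ u = r 0, y u) :
    ∃ p, (DistSpec.unfoldCycle G γ p).Connected ∧
      distForm G y + (∑ u with γ u = r 0, y u) * (∑ u with γ u ≠ r 0, y u) ≤
        distForm (DistSpec.unfoldCycle G γ p) y := by
  let idx := gateIndex r γ
  let U (q : Fin 4) := DistSpec.unfoldCycle G γ fun u => unfoldPos ℓ q (idx u)
  have hidx : ∀ u, idx u = 0 ↔ γ u = r 0 := fun u => h.gateIndex_eq_iff h.pos
  have gain := two_mul_mul_le_kerForm_unfoldGain (ℓ := ℓ) (p := idx) hy fun j => by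
    simp only [hidx]
    refine (Finset.sum_le_sum_of_subset_of_nonneg ?_ fun u _ _ => hy u).trans (hmax j)
    refine Finset.monotone_filter_right _ fun u _ hu => ?_
    simpa only [idx, h.apply_gateIndex] using congrArg r hu
  simp only [ne_eq, hidx] at gain
  have dist_le (u v : V) : 4 * (G.dist u v : ℝ) + (unfoldGain ℓ (idx u) (idx v) +
      unfoldGain ℓ (idx v) (idx u)) ≤ ∑ q, ((U q).dist u v : ℝ) := by
    have hcycle := cycleDist_add_unfoldGain_le h.three_le (h.gateIndex_lt u) (h.gateIndex_lt v)
    have hunfold := Finset.sum_le_sum fun q (_ : q ∈ Finset.univ) =>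
      h.dist_add_le_dist_unfoldCycle hG (isNumbering_unfoldPos h.three_le q) u v
    simp only [Finset.sum_add_distrib, Finset.sum_sub_distrib, Finset.sum_const, Finset.card_univ,
      Fintype.card_fin, nsmul_eq_mul] at hunfold
    push_cast at hunfold
    exact_mod_cast show 4 * (G.dist u v : ℤ) + (unfoldGain ℓ (idx u) (idx v) +
      unfoldGain ℓ (idx v) (idx u)) ≤ ∑ q, ((U q).dist u v : ℤ) by linarith
  have total := kerForm_mono (fun v (_ : v ∈ Finset.univ) => hy v) fun u _ v _ => dist_le u v
  rw [kerForm_add, kerForm_const_mul, kerForm_add,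
    kerForm_swap (k := fun u v => (unfoldGain ℓ (idx u) (idx v) : ℝ)), kerForm_sum] at total
  obtain ⟨q, -, hq⟩ := Finset.exists_le_of_sum_le (s := Finset.univ)
    (f := fun _ : Fin 4 => distForm G y + (∑ u with γ u = r 0, y u) * ∑ u with γ u ≠ r 0, y u)
    (g := fun q => distForm (U q) y) Finset.univ_nonempty (by
      rw [Finset.sum_const, Finset.card_univ, Fintype.card_fin, nsmul_eq_mul]
      unfold distForm
      push_cast
      linarith)
  exact ⟨_, unfoldCycle_connected h hG.preconnected (isNumbering_unfoldPos h.three_le q), hq⟩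

theorem exists_unfold (h : GatedCycle G ℓ r γ) (hG : G.Connected) (hy : ∀ v, 0 ≤ y v) {P : ℝ}
    (w : V) (hP : P ≤ ∑ u with γ u = γ w, y u) (hP' : P ≤ ∑ u with γ u ≠ γ w, y u) :
    ∃ p, (DistSpec.unfoldCycle G γ p).Connected ∧
      distForm G y + P * (∑ u, y u - P) ≤ distForm (DistSpec.unfoldCycle G γ p) y := by
  have : Nonempty V := ⟨w⟩
  obtain ⟨v, hv⟩ := Finite.exists_max fun v => ∑ u with γ u = γ v, y u
  obtain ⟨k, hk⟩ := h.gate_mem v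
  have hsum := Finset.sum_filter_add_sum_filter_not Finset.univ (fun u => γ u = γ v) y
  have hrest : P ≤ ∑ u with γ u ≠ γ v, y u := by
    by_cases hwv : γ w = γ v
    · rwa [← hwv]
    · refine hP.trans (Finset.sum_le_sum_of_subset_of_nonneg ?_ fun u _ _ => hy u)
      exact Finset.monotone_filter_right _ fun u _ hu => hu.trans_ne hwv
  obtain ⟨p, hconn, hle⟩ := (h.rotate k).exists_unfold_of_forall_le hG hy fun j => by
    simpa only [zero_add, hk, h.gate_self] using hv (r (j + k))
  simp only [zero_add, hk] at hle
  refine ⟨p, hconn, ?_⟩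
  rw [← hsum]
  linarith [mul_nonneg (sub_nonneg.2 (hP.trans (hv w))) (sub_nonneg.2 hrest)]

end GatedCycle

end Gain

section Cycles

variable {V : Type*} {G : SimpleGraph V} {ℓ : ℕ} {r : ℕ → V}

theorem exists_indexedCycle {v : V} {p : G.Walk v v} (hp : p.IsCycle) :
    ∃ ℓ r, IndexedCycle G ℓ r ∧ cycleEdges r = {e | e ∈ p.edges} := by
  have three_le := hp.three_le_length
  have mod_lt (j : ℕ) : j % p.length < p.length := Nat.mod_lt _ (by omega)
  have succ (j : ℕ) : p.getVert ((j + 1) % p.length) = p.getVert (j % p.length + 1) := by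
    rw [Nat.add_mod, Nat.mod_eq_of_lt (show 1 < p.length by omega)]
    rcases (Nat.succ_le_of_lt (mod_lt j)).lt_or_eq with hlt | heq
    · rw [Nat.mod_eq_of_lt hlt]
    · rw [show j % p.length + 1 = p.length from heq, Nat.mod_self, p.getVert_zero,
        p.getVert_length]
  have hedges : cycleEdges (fun j => p.getVert (j % p.length)) = {e | e ∈ p.edges} := by
    ext e
    simp only [cycleEdges, succ, Set.mem_range, Set.mem_ofPred_eq]
    induction e with
    | _ a b =>
      rw [p.mk_mem_edges_iff_exists]
      refine ⟨fun ⟨j, hj⟩ => ⟨_, mod_lt j, hj⟩, fun ⟨j, hj, he⟩ => ⟨j, ?_⟩⟩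
      rwa [Nat.mod_eq_of_lt hj]
  refine ⟨p.length, _, ⟨three_le, fun i j => ⟨fun h => ?_, fun h => by simp only [h]⟩,
    fun j => p.adj_of_mem_edges (Set.ext_iff.1 hedges _ |>.1 ⟨j, rfl⟩)⟩, hedges⟩
  have := mod_lt i
  have := mod_lt j
  exact hp.getVert_injOn' (show i % p.length ≤ p.length - 1 by omega)
    (show j % p.length ≤ p.length - 1 by omega) h

namespace IndexedCycle

theorem apply_ne_zero (h : IndexedCycle G ℓ r) {i : ℕ} (hi : i ≠ 0) (hiℓ : i < ℓ) : r i ≠ r 0 :=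
  fun e => hi (h.injOn hiℓ h.pos e)

theorem apply_sub_one_add_one (h : IndexedCycle G ℓ r) : r (ℓ - 1 + 1) = r 0 :=
  (h.eq_iff _ _).2 (by rw [Nat.sub_add_cancel h.pos, Nat.mod_self, Nat.zero_mod])

theorem reachable_arc (h : IndexedCycle G ℓ r) {k : ℕ} (hk : k + 1 < ℓ) :
    ((G.deleteEdges {s(r (ℓ - 1), r 0)}).deleteEdges {s(r 0, r 1)}).Reachable
      (r 1) (r (k + 1)) := by
  induction k with
  | zero => exact SimpleGraph.Reachable.refl _
  | succ k ih =>
    refine (ih (by omega)).trans (SimpleGraph.Adj.reachable ?_)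
    have hk₁ := h.apply_ne_zero (Nat.succ_ne_zero k) (by omega)
    have hk₂ := h.apply_ne_zero (Nat.succ_ne_zero (k + 1)) hk
    simp only [SimpleGraph.deleteEdges_adj, Set.mem_singleton_iff, Sym2.eq_iff]
    exact ⟨⟨h.adj (k + 1), by grind⟩, by grind⟩

theorem not_reachable_deleteEdges (h : IndexedCycle G ℓ r)
    (hcyc : ∀ u (q : G.Walk u u), q.IsCycle → s(r 0, r 1) ∈ q.edges →
      s(r (ℓ - 1), r 0) ∈ q.edges) {i : ℕ} (hi : i ≠ 0) (hiℓ : i < ℓ) :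
    ¬ (G.deleteEdges (cycleEdges r)).Reachable (r 0) (r i) := by
  intro hreach
  have hℓ := h.three_le
  let G' := G.deleteEdges {s(r (ℓ - 1), r 0)}
  have hadj : G'.Adj (r 0) (r 1) := by
    refine SimpleGraph.deleteEdges_adj.2 ⟨h.adj 0, fun e => ?_⟩
    have ne₁ : r 1 ≠ r 0 := h.apply_ne_zero one_ne_zero (by omega)
    have ne₂ : r 1 ≠ r (ℓ - 1) := fun e =>
      absurd (h.injOn (show 1 < ℓ by omega) (show ℓ - 1 < ℓ by omega) e) (by omega)
    rw [Set.mem_singleton_iff, Sym2.eq_iff] at e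
    grind
  have hle : G.deleteEdges (cycleEdges r) ≤ G'.deleteEdges {s(r 0, r 1)} := by
    rw [SimpleGraph.deleteEdges_deleteEdges]
    refine SimpleGraph.deleteEdges_anti ?_
    rintro _ (rfl | rfl)
    · exact ⟨ℓ - 1, congrArg (s(r (ℓ - 1), ·)) h.apply_sub_one_add_one⟩
    · exact ⟨0, rfl⟩
  have harc := h.reachable_arc (k := i - 1) (by omega)
  rw [Nat.sub_add_cancel (Nat.pos_of_ne_zero hi)] at harc
  obtain ⟨u, q, hq, hmem⟩ := SimpleGraph.adj_and_reachable_delete_edges_iff_exists_cycle.1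
    ⟨hadj, (hreach.mono hle).trans harc.symm⟩
  have hG' : G' ≤ G := SimpleGraph.deleteEdges_le _
  have hlast := hcyc u (q.mapLe hG') (hq.mapLe hG')
    (by rwa [SimpleGraph.Walk.edges_mapLe_eq_edges])
  rw [SimpleGraph.Walk.edges_mapLe_eq_edges] at hlast
  exact (SimpleGraph.deleteEdges_adj.1 (q.adj_of_mem_edges hlast)).2 rfl

theorem eq_of_reachable_deleteEdges (h : IndexedCycle G ℓ r)
    (hcyc : ∀ u (q : G.Walk u u), q.IsCycle → ∀ e ∈ q.edges, e ∈ cycleEdges r →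
      ∀ e' ∈ cycleEdges r, e' ∈ q.edges) {i j : ℕ}
    (hreach : (G.deleteEdges (cycleEdges r)).Reachable (r i) (r j)) : r i = r j := by
  obtain ⟨k, hk⟩ := h.exists_add_eq j i
  by_contra hne
  have hmod : k % ℓ ≠ 0 := fun hk0 => hne <| by
    have : r (0 + i) = r (k + i) := (h.eq_iff _ _).2 (Nat.ModEq.add_right i
      ((Nat.zero_mod ℓ).trans hk0.symm))
    rwa [zero_add, hk, h.add_mul] at this
  have hrot := h.rotate i
  refine hrot.not_reachable_deleteEdges (fun u q hq hmem => hcyc u q hq _ hmem ?_ _ ?_)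
    hmod (Nat.mod_lt k h.pos) ?_
  · exact h.cycleEdges_add i ▸ ⟨0, rfl⟩
  · exact h.cycleEdges_add i ▸
      ⟨ℓ - 1, congrArg (s(r (ℓ - 1 + i), ·)) hrot.apply_sub_one_add_one⟩
  · rw [h.cycleEdges_add, (hrot.eq_iff (k % ℓ) k).2 (Nat.mod_mod _ _), hk, h.add_mul, zero_add]
    exact hreach

theorem exists_reachable_deleteEdges (hG : G.Preconnected) (u : V) :
    ∃ j, (G.deleteEdges (cycleEdges r)).Reachable (r j) u := by
  obtain ⟨p⟩ := hG (r 0) u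
  suffices ∀ a b, G.Walk a b → (∃ j, (G.deleteEdges (cycleEdges r)).Reachable (r j) a) →
      ∃ j, (G.deleteEdges (cycleEdges r)).Reachable (r j) b from this _ _ p ⟨0, .refl _⟩
  intro a b q
  induction q with
  | nil => exact id
  | @cons a b c hab _ ih =>
    rintro ⟨j, hj⟩
    refine ih ?_
    by_cases hmem : s(a, b) ∈ cycleEdges r
    · obtain ⟨k, hk⟩ := hmem
      rcases Sym2.eq_iff.1 hk with ⟨-, rfl⟩ | ⟨rfl, -⟩
      · exact ⟨k + 1, .refl _⟩
      · exact ⟨k, .refl _⟩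
    · exact ⟨j, hj.trans (SimpleGraph.deleteEdges_adj.2 ⟨hab, hmem⟩).reachable⟩

theorem exists_gatedCycle (h : IndexedCycle G ℓ r) (hG : G.Preconnected)
    (hcyc : ∀ u (q : G.Walk u u), q.IsCycle → ∀ e ∈ q.edges, e ∈ cycleEdges r →
      ∀ e' ∈ cycleEdges r, e' ∈ q.edges) :
    ∃ γ, GatedCycle G ℓ r γ := by
  choose g hg using exists_reachable_deleteEdges (r := r) hG
  refine ⟨fun u => r (g u), { h with
    gate_mem := fun u => ⟨g u, rfl⟩
    gate_self := fun j => h.eq_of_reachable_deleteEdges hcyc (hg (r j))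
    edge := fun u v huv => or_iff_not_imp_right.2 fun hmem => ?_ }⟩
  exact h.eq_of_reachable_deleteEdges hcyc ((hg u).trans
    ((SimpleGraph.deleteEdges_adj.2 ⟨huv, hmem⟩).reachable.trans (hg v).symm))

end IndexedCycle

theorem GatedCycle.gate_eq_of_disjoint {γ : V → V} (h : GatedCycle G ℓ r γ) {ℓ' : ℕ} {r' : ℕ → V}
    (h' : IndexedCycle G ℓ' r') (hd : Disjoint (cycleEdges r) (cycleEdges r')) (j : ℕ) :
    γ (r' j) = γ (r' 0) := by
  induction j with
  | zero => rfl
  | succ j ih =>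
    rw [← ih]
    exact ((h.edge _ _ (h'.adj j)).resolve_right fun hmem =>
      Set.disjoint_left.1 hd hmem ⟨j, rfl⟩).symm

theorem exists_connected_forall_isBridge [Finite V] (hG : G.Connected) {E : Set (Sym2 V)}
    (hE : E ⊆ G.edgeSet) :
    ∃ G₀ ≤ G, G₀.Connected ∧ E ⊆ G₀.edgeSet ∧ ∀ e ∈ G₀.edgeSet, e ∉ E → G₀.IsBridge e := by
  obtain ⟨G₀, hmin⟩ := (Set.toFinite {G' : SimpleGraph V | G' ≤ G ∧ E ⊆ G'.edgeSet ∧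
    G'.Connected}).exists_minimal ⟨G, le_rfl, hE, hG⟩
  obtain ⟨hle, hE₀, hconn⟩ := hmin.prop
  refine ⟨G₀, hle, hconn, hE₀, fun e he heE => ?_⟩
  by_contra hbridge
  induction e with
  | _ a b =>
    have hdel := hmin.le_of_le (y := G₀.deleteEdges {s(a, b)})
      ⟨(SimpleGraph.deleteEdges_le _).trans hle, fun f hf => ?_,
        hconn.connected_delete_edge_of_not_isBridge hbridge⟩ (SimpleGraph.deleteEdges_le _)
    · exact (SimpleGraph.deleteEdges_adj.1 (hdel he)).2 rfl
    · rw [SimpleGraph.edgeSet_deleteEdges]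
      exact ⟨hE₀ hf, fun hfe => heE (Set.mem_singleton_iff.1 hfe ▸ hf)⟩

theorem IsCycleSubgraph.le_edgeInduced {C : G.Subgraph} (hC : IsCycleSubgraph C)
    {S : Set (Sym2 V)} (hS : C.edgeSet ⊆ S) : C ≤ edgeInduced G S := by
  obtain ⟨v, p, hp, rfl⟩ := hC
  refine ⟨fun u hu => ?_, fun a b hab => ⟨hab.adj_sub, hS hab⟩⟩
  rw [SimpleGraph.Walk.mem_verts_toSubgraph,
    SimpleGraph.Walk.mem_support_iff_exists_mem_edges_of_not_nil hp.not_nil] at hu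
  obtain ⟨e, he, hue⟩ := hu
  obtain ⟨w, rfl⟩ := Sym2.mem_iff_exists.1 hue
  exact ⟨w, p.adj_of_mem_edges he, hS (p.mem_edges_toSubgraph.2 he)⟩

theorem IsCycleSubgraph.edgeSet_nonempty {C : G.Subgraph} (hC : IsCycleSubgraph C) :
    C.edgeSet.Nonempty := by
  obtain ⟨v, p, hp, rfl⟩ := hC
  obtain ⟨e, he, -⟩ := (SimpleGraph.Walk.mem_support_iff_exists_mem_edges_of_not_nil hp.not_nil).1
    p.start_mem_support
  exact ⟨e, p.mem_edges_toSubgraph.2 he⟩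

theorem IsCycleSubgraph.ne_of_disjoint {C D : G.Subgraph} (hC : IsCycleSubgraph C)
    (hCD : Disjoint C.edgeSet D.edgeSet) : C ≠ D := by
  rintro rfl
  exact hC.edgeSet_nonempty.ne_empty (disjoint_self.1 hCD)

theorem AreCactusTypeCycles.eq_of_edgeSet_subset {G₁ G₂ G₃ : G.Subgraph}
    (h : AreCactusTypeCycles G₁ G₂ G₃) {C : G.Subgraph} (hC : IsCycleSubgraph C)
    (hsub : C.edgeSet ⊆ G₁.edgeSet ∪ G₂.edgeSet ∪ G₃.edgeSet) : C = G₁ ∨ C = G₂ ∨ C = G₃ := by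
  obtain ⟨h₁, h₂, h₃, h₁₂, h₁₃, h₂₃, hcard⟩ := h
  have hle : ({G₁, G₂, G₃} : Set G.Subgraph) ⊆ {C : G.Subgraph | IsCycleSubgraph C ∧
      C ≤ edgeInduced G (G₁.edgeSet ∪ G₂.edgeSet ∪ G₃.edgeSet)} := by
    rintro A (rfl | rfl | rfl)
    · exact ⟨h₁, h₁.le_edgeInduced fun e he => Or.inl (Or.inl he)⟩
    · exact ⟨h₂, h₂.le_edgeInduced fun e he => Or.inl (Or.inr he)⟩
    · exact ⟨h₃, h₃.le_edgeInduced fun e he => Or.inr he⟩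
  have hthree : ({G₁, G₂, G₃} : Set G.Subgraph).encard = 3 :=
    Set.encard_eq_three.2 ⟨_, _, _, h₁.ne_of_disjoint h₁₂, h₁.ne_of_disjoint h₁₃,
      h₂.ne_of_disjoint h₂₃, rfl⟩
  have heq := (Set.toFinite _).eq_of_subset_of_encard_le hle (by rw [hthree, hcard])
  exact heq.ge ⟨hC, hC.le_edgeInduced hsub⟩

/-- A family of gated cycles in `G`, each of which hangs at a single vertex of every other one. -/
structure GatedFamily {ι : Type*} (G : SimpleGraph V) (ℓ : ι → ℕ) (r : ι → ℕ → V)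
    (γ : ι → V → V) : Prop where
  gated : ∀ i, GatedCycle G (ℓ i) (r i) (γ i)
  gate_eq : ∀ i j, i ≠ j → ∀ a, γ i (r j a) = γ i (r j 0)

theorem exists_gatedFamily [Finite V] {ι : Type*} (hG : G.Connected) {C : ι → G.Subgraph}
    (hC : ∀ i, IsCycleSubgraph (C i))
    (hdisj : ∀ i j, i ≠ j → Disjoint (C i).edgeSet (C j).edgeSet)
    (honly : ∀ D, IsCycleSubgraph D → D.edgeSet ⊆ ⋃ i, (C i).edgeSet → ∃ i, D = C i) :
    ∃ G₀ ≤ G, G₀.Connected ∧ ∃ ℓ r γ, GatedFamily (ι := ι) G₀ ℓ r γ := by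
  obtain ⟨G₀, hle, hconn, hCG₀, hbridge⟩ := exists_connected_forall_isBridge hG
    (Set.iUnion_subset fun i => (C i).edgeSet_subset)
  have hcycle (u) (q : G₀.Walk u u) (hq : q.IsCycle) :
      ∃ i, ∀ e, e ∈ q.edges ↔ e ∈ (C i).edgeSet := by
    have hmem (e) : e ∈ (q.mapLe hle).toSubgraph.edgeSet ↔ e ∈ q.edges := by
      rw [SimpleGraph.Walk.mem_edges_toSubgraph, SimpleGraph.Walk.edges_mapLe_eq_edges]
    obtain ⟨i, hi⟩ := honly (q.mapLe hle).toSubgraph ⟨u, _, hq.mapLe hle, rfl⟩ fun e he => by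
      rw [hmem] at he
      by_contra hn
      exact (hbridge e (q.edges_subset_edgeSet he) hn).notMem_edges_of_isCycle hq he
    exact ⟨i, fun e => by rw [← hi, hmem]⟩
  have hgate (i) : ∃ ℓ r γ, GatedCycle G₀ ℓ r γ ∧ cycleEdges r = (C i).edgeSet := by
    obtain ⟨v, p, hp, hpC⟩ := hC i
    have hmem (e) : e ∈ p.edges ↔ e ∈ (C i).edgeSet := by
      rw [← hpC, SimpleGraph.Walk.mem_edges_toSubgraph]
    have hp₀ (e) (he : e ∈ p.edges) : e ∈ G₀.edgeSet :=
      hCG₀ (Set.mem_iUnion_of_mem i ((hmem e).1 he))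
    obtain ⟨ℓ, r, hr, hedges⟩ := exists_indexedCycle (hp.transfer hp₀)
    replace hedges : cycleEdges r = (C i).edgeSet := hedges.trans <| Set.ext fun e => by
      rw [Set.mem_ofPred_eq, p.edges_transfer, hmem]
    obtain ⟨γ, hγ⟩ := hr.exists_gatedCycle hconn.preconnected fun u q hq e heq her e' her' => by
      obtain ⟨k, hk⟩ := hcycle u q hq
      rw [hedges] at her her'
      rw [hk] at heq ⊢
      obtain rfl : i = k := by_contra fun hik => Set.disjoint_left.1 (hdisj i k hik) her heq
      exact her'
    exact ⟨ℓ, r, γ, hγ, hedges⟩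
  choose ℓ r γ hγ hedges using hgate
  refine ⟨G₀, hle, hconn, ℓ, r, γ, hγ, fun i j hij => ?_⟩
  exact (hγ i).gate_eq_of_disjoint (hγ j).toIndexedCycle (by
    rw [hedges, hedges]
    exact hdisj i j hij)

theorem AreCactusTypeCycles.exists_gatedFamily [Finite V] (hG : G.Connected)
    {G₁ G₂ G₃ : G.Subgraph} (h : AreCactusTypeCycles G₁ G₂ G₃) :
    ∃ G₀ ≤ G, G₀.Connected ∧ ∃ ℓ r γ, GatedFamily (ι := Fin 3) G₀ ℓ r γ := by
  have ⟨h₁, h₂, h₃, h₁₂, h₁₃, h₂₃, _⟩ := h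
  refine DistSpec.exists_gatedFamily hG (C := ![G₁, G₂, G₃]) ?_ ?_ fun D hD hsub => ?_
  · simp only [Fin.forall_fin_succ]
    exact ⟨h₁, h₂, h₃, nofun⟩
  · have := h₁₂.symm
    have := h₁₃.symm
    have := h₂₃.symm
    intro i j hij
    fin_cases i <;> fin_cases j <;> first | exact absurd rfl hij | assumption
  · have hsub' : D.edgeSet ⊆ G₁.edgeSet ∪ G₂.edgeSet ∪ G₃.edgeSet := fun e he => by
      obtain ⟨i, hi⟩ := Set.mem_iUnion.1 (hsub he)
      fin_cases i
      exacts [Or.inl (Or.inl hi), Or.inl (Or.inr hi), Or.inr hi]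
    rcases h.eq_of_edgeSet_subset hD hsub' with rfl | rfl | rfl
    exacts [⟨0, rfl⟩, ⟨1, rfl⟩, ⟨2, rfl⟩]

end Cycles

section EndCycle

variable {V : Type*} {G : SimpleGraph V}

theorem IndexedCycle.exists_apply_ne {ℓ : ℕ} {r : ℕ → V} (h : IndexedCycle G ℓ r) (u : V) :
    ∃ j, r j ≠ u := by
  by_cases h₀ : r 0 = u
  · exact ⟨1, h₀ ▸ (h.adj 0).ne'⟩
  · exact ⟨0, h₀⟩

theorem GatedCycle.pile_preconnected {ℓ : ℕ} {r : ℕ → V} {γ : V → V} (h : GatedCycle G ℓ r γ)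
    (hG : G.Preconnected) {w : V} (hw : γ w = w) : (G.induce {u | γ u = w}).Preconnected := by
  have reach := reachable_of_forall_exists_adj_lt (G := G.induce {u | γ u = w}) (r := ⟨w, hw⟩)
    (fun u => G.dist w u) fun u hu => by
      have hγu : γ u = w := u.2
      obtain ⟨z, hadj, hγz, hlt⟩ := h.exists_parent hG (u := u) fun e =>
        hu (Subtype.ext (e.symm.trans hγu))
      rw [hγu] at hγz hlt
      exact ⟨⟨z, hγz⟩, hadj, hlt⟩
  exact fun u v => (reach u).trans (reach v).symm

namespace GatedFamily

variable {ι : Type*} {ℓ : ι → ℕ} {r : ι → ℕ → V} {γ : ι → V → V}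

theorem gate_eq_of_gate_ne (h : GatedFamily G ℓ r γ) (hG : G.Preconnected) {i j : ι} (hij : i ≠ j)
    {u : V} (hu : γ j u ≠ γ j (r i 0)) : γ i u = γ i (r j 0) := by
  induction u using (measure fun u => G.dist (γ j u) u).wf.induction with
  | _ u ih =>
    by_cases hγ : γ j u = u
    · obtain ⟨a, ha⟩ := (h.gated j).gate_mem u
      rw [← hγ, ← ha, h.gate_eq i j hij]
    · obtain ⟨z, hadj, hγz, hlt⟩ := (h.gated j).exists_parent hG hγ
      rw [← ih z (show G.dist (γ j z) z < G.dist (γ j u) u from hγz.symm ▸ hlt) (hγz.symm ▸ hu)]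
      refine ((h.gated i).edge_gate hadj).resolve_right fun e => hu ?_
      obtain ⟨a, ha⟩ := (h.gated i).gate_mem u
      rw [← e.1, ← ha, h.gate_eq j i hij.symm]

variable [Fintype V] [DecidableEq V] {x : V → ℝ}

theorem sum_gate_ne_lt (h : GatedFamily G ℓ r γ) (hG : G.Preconnected) (hx : ∀ v, 0 < x v)
    {i j k : ι} (hik : i ≠ k) (hne : γ i (r k 0) ≠ γ i (r j 0)) :
    ∑ u with γ k u ≠ γ k (r i 0), x u < ∑ u with γ i u ≠ γ i (r j 0), x u := by
  obtain ⟨a, ha⟩ := (h.gated i).exists_apply_ne (γ i (r j 0))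
  refine Finset.sum_lt_sum_of_subset (i := r i a) ?_ ?_ ?_ (hx _) fun u _ _ => (hx u).le
  · refine Finset.monotone_filter_right _ fun u _ hu => ?_
    rwa [h.gate_eq_of_gate_ne hG hik hu]
  · simpa [(h.gated i).gate_self] using ha
  · simp [h.gate_eq k i hik.symm]

theorem exists_end_cycle [Finite ι] [Nontrivial ι] (h : GatedFamily G ℓ r γ)
    (hG : G.Preconnected) (hx : ∀ v, 0 < x v) :
    ∃ i w, γ i w = w ∧ (∀ k ≠ i, ∀ a, γ i (r k a) = w) ∧
      ∀ k ≠ i, ∑ u with γ i u ≠ w, x u ≤ ∑ u with γ k u ≠ γ k w, x u := by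
  obtain ⟨i₀, j₀, hij₀⟩ := exists_pair_ne ι
  obtain ⟨⟨i, j⟩, -, hmin⟩ := (Set.toFinite {p : ι × ι | p.1 ≠ p.2}).exists_minimalFor
    (fun p => ∑ u with γ p.1 u ≠ γ p.1 (r p.2 0), x u) _ ⟨(i₀, j₀), hij₀⟩
  replace hmin {k : ι} (hk : k ≠ i) : ∑ u with γ i u ≠ γ i (r j 0), x u ≤
      ∑ u with γ k u ≠ γ k (r i 0), x u := le_of_not_gt fun hlt =>
    hlt.not_ge (hmin (j := (k, i)) hk hlt.le)
  obtain ⟨a, ha⟩ := (h.gated i).gate_mem (r j 0)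
  refine ⟨i, γ i (r j 0), (h.gated i).gate_gate _, fun k hk b => ?_, fun k hk => ?_⟩
  · rw [h.gate_eq i k hk.symm]
    by_contra hne
    exact (h.sum_gate_ne_lt hG hx hk.symm hne).not_ge (hmin hk)
  · simpa only [← ha, h.gate_eq k i hk] using hmin hk

end GatedFamily

end EndCycle

section Pile

variable {V : Type*}

theorem IsNumbering.exists_sum_mul_abs_sub_le {s : Finset V} {t : V → ℕ} (ht : IsNumbering s t)
    {x : V → ℝ} (hx : ∀ v ∈ s, 0 ≤ x v) {w : V} (hw : w ∈ s) :
    ∃ t', IsNumbering s t' ∧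
      kerForm s (fun u v => |(t' u : ℝ) - t' v|) x = kerForm s (fun u v => |(t u : ℝ) - t v|) x ∧
      ∑ v ∈ s, x v * |(t w : ℝ) - t v| ≤ ∑ v ∈ s, x v * t' v := by
  have convex : ConvexOn ℝ Set.univ (∑ v ∈ s, fun c => x v * |c - (t v : ℝ)|) :=
    Finset.sum_induction _ (ConvexOn ℝ Set.univ) (fun _ _ => ConvexOn.add)
      (convexOn_const 0 convex_univ) fun v hv => (convexOn_univ_dist (t v : ℝ)).smul (hx v hv)
  have hcard := ht.lt w hw
  have hle := convex.le_max_of_mem_Icc (Set.mem_univ 0) (Set.mem_univ ((s.card : ℝ) - 1))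
    (z := (t w : ℝ)) ⟨Nat.cast_nonneg _, le_sub_iff_add_le.2 (by exact_mod_cast hcard)⟩
  simp only [Finset.sum_apply] at hle
  rcases le_max_iff.1 hle with hle | hle
  · refine ⟨t, ht, rfl, hle.trans_eq ?_⟩
    simp
  · refine ⟨_, ht.reflect, ht.kerForm_reflect x, hle.trans_eq ?_⟩
    refine Finset.sum_congr rfl fun v hv => ?_
    rw [← ht.cast_reflect hv, abs_of_nonneg (Nat.cast_nonneg _)]

variable [DecidableEq V]

theorem kerForm_indicator [Fintype V] (s : Finset V) (k : V → V → ℝ) (y : V → ℝ) :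
    kerForm Finset.univ k (fun v => if v ∈ s then y v else 0) = kerForm s k y := by
  simp only [kerForm, ite_mul, mul_ite, zero_mul, mul_zero, Finset.sum_ite_mem, Finset.univ_inter,
    Finset.sum_ite_irrel, Finset.sum_const_zero]

theorem kerForm_add_single {s : Finset V} {k : V → V → ℝ} (hk : ∀ u v, k u v = k v u) {w : V}
    (hw : w ∈ s) (hkw : k w w = 0) (x : V → ℝ) (c : ℝ) :
    kerForm s k (fun v => x v + if v = w then c else 0) =
      kerForm s k x + 2 * (c * ∑ v ∈ s, x v * k w v) := by
  simp only [kerForm, add_mul, mul_add, Finset.sum_add_distrib, ite_mul, mul_ite, zero_mul,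
    mul_zero, Finset.sum_ite_irrel, Finset.sum_const_zero, Finset.sum_ite_eq', hw, if_true, hkw,
    Finset.mul_sum, two_mul]
  rw [add_zero, add_assoc]
  refine congrArg₂ _ rfl (congrArg₂ _ ?_ ?_) <;>
    exact Finset.sum_congr rfl fun v _ => by rw [hk w v]; ring

namespace GatedFamily

variable [Fintype V] {G : SimpleGraph V} {ι : Type*} {ℓ : ι → ℕ} {r : ι → ℕ → V}
  {γ : ι → V → V} {P : ℝ}

theorem exists_unfold (h : GatedFamily G ℓ r γ) (hG : G.Connected) {y : V → ℝ}
    (hy : ∀ v, 0 ≤ y v) (w : V) (J : Finset ι)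
    (hP : ∀ j ∈ J, P ≤ ∑ u with γ j u = γ j w, y u)
    (hP' : ∀ j ∈ J, P ≤ ∑ u with γ j u ≠ γ j w, y u) :
    ∃ H : SimpleGraph V, H.Connected ∧ (∀ i ∉ J, GatedCycle H (ℓ i) (r i) (γ i)) ∧
      distForm G y + J.card * (P * (∑ u, y u - P)) ≤ distForm H y := by
  classical
  induction J using Finset.induction with
  | empty => exact ⟨G, hG, fun i _ => h.gated i, by simp⟩
  | insert j J hj ih =>
    rw [Finset.forall_mem_insert] at hP hP'
    obtain ⟨H, hH, hgated, hle⟩ := ih hP.2 hP'.2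
    obtain ⟨p, hconn, hle'⟩ := (hgated j hj).exists_unfold hH hy w hP.1 hP'.1
    refine ⟨_, hconn, fun i hi => ?_, ?_⟩
    · rw [Finset.mem_insert, not_or] at hi
      refine (hgated i hi.2).unfoldCycle (h.gate_eq j i (Ne.symm hi.1)) (fun u v hu hv => ?_) p
      obtain ⟨a, ha⟩ := (h.gated j).gate_mem u
      obtain ⟨b, hb⟩ := (h.gated j).gate_mem v
      rw [← hu, ← hv, ← ha, ← hb, h.gate_eq i j hi.1 a, h.gate_eq i j hi.1 b]
    · rw [Finset.card_insert_of_notMem hj]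
      push_cast
      linarith

theorem exists_unfold_pile [Fintype ι] (hι : 3 ≤ Fintype.card ι) (h : GatedFamily G ℓ r γ)
    (hG : G.Connected) {x : V → ℝ} (hx : ∀ v, 0 ≤ x v) {i : ι} {w : V} (hw : γ i w = w)
    (hend : ∀ k ≠ i, ∀ a, γ i (r k a) = w) (hP₀ : 0 ≤ P)
    (hP : ∀ k ≠ i, P ≤ ∑ u with γ k u ≠ γ k w, x u) :
    ∃ H : SimpleGraph V, H.Connected ∧ GatedCycle H (ℓ i) (r i) (γ i) ∧
      kerForm (Finset.univ.filter fun u => γ i u = w) (fun u v => (G.dist u v : ℝ))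
          (fun u => x u + if u = w then P else 0) + 2 * (P * ∑ q with γ i q = w, x q) ≤
        kerForm (Finset.univ.filter fun u => γ i u = w) (fun u v => (H.dist u v : ℝ))
          (fun u => x u + if u = w then P else 0) := by
  classical
  set Q := Finset.univ.filter fun u => γ i u = w with hQ
  have mem_Q (u : V) : u ∈ Q ↔ γ i u = w := by simp [hQ]
  -- The vertices outside the pile enter as the additional weight `P` at `w`.
  let y (u : V) : ℝ := x u + if u = w then P else 0
  have x_le_y (u : V) : x u ≤ y u := le_add_of_nonneg_right (by split_ifs <;> simp [hP₀])
  have ite_nonneg (u : V) : 0 ≤ if u ∈ Q then y u else 0 := by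
    split_ifs <;> simp [(hx u).trans (x_le_y u)]
  obtain ⟨a, ha⟩ := (h.gated i).gate_mem w
  obtain ⟨H, hH, hgated, hle⟩ := h.exists_unfold hG ite_nonneg w (P := P) (Finset.univ.erase i)
    (fun k _ => by
      refine le_trans ?_ (Finset.single_le_sum (a := w) (fun u _ => ite_nonneg u) (by simp))
      simp [mem_Q, hw, y, hx])
    (fun k hk => by
      have hki := Finset.ne_of_mem_erase hk
      refine (hP k hki).trans (Finset.sum_le_sum fun u hu => ?_)
      have hu' : γ k u ≠ γ k (r i 0) := by
        simpa [← h.gate_eq k i hki a, ha, hw] using hu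
      rw [if_pos ((mem_Q u).2 ((h.gate_eq_of_gate_ne hG.preconnected hki.symm hu').trans
        (hend k hki 0)))]
      exact x_le_y u)
  refine ⟨H, hH, hgated i (Finset.notMem_erase i _), ?_⟩
  have total : ∑ u, (if u ∈ Q then y u else 0) = ∑ q ∈ Q, x q + P := by
    rw [Finset.sum_ite_mem, Finset.univ_inter, Finset.sum_add_distrib, Finset.sum_ite_eq' Q w,
      if_pos ((mem_Q w).2 hw)]
  have two_le : (2 : ℝ) ≤ (Finset.univ.erase i).card := by
    rw [Finset.card_erase_of_mem (Finset.mem_univ i)]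
    exact_mod_cast Nat.le_sub_one_of_lt hι
  rw [total, add_sub_cancel_right, distForm, distForm, kerForm_indicator, kerForm_indicator] at hle
  linarith [mul_le_mul_of_nonneg_right two_le
    (mul_nonneg hP₀ (Finset.sum_nonneg fun q (_ : q ∈ Q) => hx q))]

theorem exists_isNumbering_pile [Fintype ι] (hι : 3 ≤ Fintype.card ι) (h : GatedFamily G ℓ r γ)
    (hG : G.Connected) {x : V → ℝ} (hx : ∀ v, 0 ≤ x v) {i : ι} {w : V} (hw : γ i w = w)
    (hend : ∀ k ≠ i, ∀ a, γ i (r k a) = w) (hP₀ : 0 ≤ P)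
    (hP : ∀ k ≠ i, P ≤ ∑ u with γ k u ≠ γ k w, x u) :
    ∃ t, IsNumbering (Finset.univ.filter fun u => γ i u = w) t ∧
      2 * (P * ∑ q with γ i q = w, x q * (1 - (t q - G.dist w q))) ≤
        kerForm (Finset.univ.filter fun u => γ i u = w)
          (fun u v => |(t u : ℝ) - t v| - G.dist u v) x := by
  obtain ⟨H, hH, hgated, hle⟩ := h.exists_unfold_pile hι hG hx hw hend hP₀ hP
  set Q := Finset.univ.filter fun u => γ i u = w with hQ
  have mem_Q (u : V) : u ∈ Q ↔ γ i u = w := by simp [hQ]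
  have hconn : (H.induce (Q : Set V)).Preconnected := by
    rw [show (Q : Set V) = {u | γ i u = w} from Set.ext mem_Q]
    exact hgated.pile_preconnected hH.preconnected hw
  obtain ⟨t, ht, hpath⟩ := exists_isNumbering_kerForm_dist_le hconn fun u =>
    add_nonneg (hx u) (show 0 ≤ if u = w then P else 0 by split_ifs <;> simp [hP₀])
  obtain ⟨t', ht', heq, hle'⟩ := ht.exists_sum_mul_abs_sub_le (fun v _ => hx v) ((mem_Q w).2 hw)
  refine ⟨t', ht', ?_⟩
  replace hle := hle.trans hpath
  rw [kerForm_add_single (fun u v => by rw [G.dist_comm]) ((mem_Q w).2 hw) (by simp),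
    kerForm_add_single (fun u v => abs_sub_comm _ _) ((mem_Q w).2 hw) (by simp)] at hle
  rw [kerForm_sub, heq]
  simp only [mul_sub, mul_one, Finset.sum_sub_distrib]
  linarith [mul_le_mul_of_nonneg_left hle' hP₀]

end GatedFamily

end Pile

section Perimeter

variable {V : Type*} {G : SimpleGraph V}

/-- The perimeter of the geodesic triangle with corners `w`, `u` and `v`. -/
noncomputable def perimeter (G : SimpleGraph V) (w u v : V) : ℕ :=
  G.dist u v + G.dist w u + G.dist w v

theorem perimeter_comm (w u v : V) : perimeter G w u v = perimeter G w v u := by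
  rw [perimeter, perimeter, G.dist_comm, add_right_comm]

theorem perimeter_self (w u : V) : perimeter G w u u = 2 * G.dist w u := by
  rw [perimeter, SimpleGraph.dist_self]
  ring

theorem perimeter_le_perimeter_add_two {u z : V} (h : G.Adj u z) (w v : V) :
    perimeter G w u v ≤ perimeter G w z v + 2 := by
  have huv := dist_le_dist_add_one h v
  have hwu := dist_le_dist_add_one h w
  rw [G.dist_comm, G.dist_comm (u := z)] at hwu
  simp only [perimeter]
  omega

theorem perimeter_le_two_mul_max {S : Finset V} {w : V} {s : V → ℕ} (hinj : Set.InjOn s S)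
    (hs : s w = 0) (hadj : ∀ u ∈ S, u ≠ w → ∃ z ∈ S, G.Adj u z ∧ s z < s u) {u v : V}
    (hu : u ∈ S) (hv : v ∈ S) : perimeter G w u v ≤ 2 * max (s u) (s v) := by
  induction hn : s u + s v using Nat.strong_induction_on generalizing u v with
  | _ n ih =>
    wlog huv : s u ≤ s v generalizing u v
    · rw [perimeter_comm, max_comm]
      exact this hv hu (by omega) (by omega)
    by_cases hvw : v = w
    · rw [hvw, hs] at huv
      rw [hvw, hinj hu (hvw ▸ hv) (by omega), perimeter_self]
      simp
    obtain ⟨z, hz, hvz, hlt⟩ := hadj v hv hvw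
    rcases huv.eq_or_lt with heq | hlt'
    · obtain rfl := hinj hu hv heq
      have hself := ih _ (by omega) hz hz rfl
      have hdist := dist_le_dist_add_one hvz w
      rw [G.dist_comm, G.dist_comm (u := z)] at hdist
      rw [perimeter_self] at hself ⊢
      omega
    · have hparent := ih _ (by omega) hu hz rfl
      have hstep := perimeter_le_perimeter_add_two hvz w u
      rw [perimeter_comm, perimeter_comm w z] at hstep
      omega

theorem exists_isNumbering_lt_of_lt (s : Finset V) (f : V → ℕ) :
    ∃ t, IsNumbering s t ∧ ∀ u ∈ s, ∀ v, f u < f v → t u < t v := by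
  classical
  obtain ⟨order, -⟩ := exists_wellFoundedLT V
  let g (v : V) : ℕ ×ₗ V := toLex (f v, v)
  have count_lt {u v : V} (hu : u ∈ s) (huv : g u < g v) :
      (s.filter fun z => g z < g u).card < (s.filter fun z => g z < g v).card :=
    Finset.card_lt_card <| (Finset.ssubset_iff_of_subset <|
      Finset.monotone_filter_right s fun z _ hz => lt_trans hz huv).2
        ⟨u, Finset.mem_filter.2 ⟨hu, huv⟩, by simp⟩
  refine ⟨fun v => (s.filter fun z => g z < g v).card, ⟨fun v hv => ?_, fun u hu v hv huv => ?_⟩,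
    fun u hu v huv => count_lt hu (Prod.Lex.toLex_lt_toLex.2 (Or.inl huv))⟩
  · exact Finset.card_lt_card (Finset.filter_ssubset.2 ⟨v, hv, lt_irrefl _⟩)
  · rcases lt_trichotomy (g u) (g v) with hlt | heq | hlt
    · exact absurd huv (count_lt hu hlt).ne
    · exact congrArg (fun p => (ofLex p).2) heq
    · exact absurd huv (count_lt hv hlt).ne'

theorem exists_isNumbering_perimeter_le {S : Finset V} {w : V} (f : V → ℕ)
    (hw : w ∈ S) (hf : ∀ u ∈ S, u ≠ w → ∃ z ∈ S, G.Adj u z ∧ f z < f u) :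
    ∃ s, IsNumbering S s ∧ s w = 0 ∧
      ∀ u ∈ S, ∀ v ∈ S, perimeter G w u v ≤ 2 * max (s u) (s v) := by
  obtain ⟨s, hs, hlt⟩ := exists_isNumbering_lt_of_lt S f
  have hadj (u : V) (hu : u ∈ S) (huw : u ≠ w) : ∃ z ∈ S, G.Adj u z ∧ s z < s u := by
    obtain ⟨z, hz, huz, hfz⟩ := hf u hu huw
    exact ⟨z, hz, huz, hlt z hz u hfz⟩
  have hsw : s w = 0 := by
    obtain ⟨u, hu, hsu⟩ := hs.exists_eq (Finset.card_pos.2 ⟨w, hw⟩)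
    by_cases huw : u = w
    · rwa [← huw]
    · obtain ⟨z, -, -, hz⟩ := hadj u hu huw
      omega
  exact ⟨s, hs, hsw, fun u hu v hv => perimeter_le_two_mul_max hs.injOn hsw hadj hu hv⟩

end Perimeter

section KiteNumbering

variable {V : Type*} {G : SimpleGraph V}

/-- A numbering of `X` by which `X` can be put onto the clique end of the kite `K₄⁽ⁿ⁾` so that the
distances in the kite are not much smaller. Since the vertices `0`, `1`, `2` of the kite are
equally far from the vertices of the tail, distances are measured by `max (c u) 2`. -/
structure IsKiteNumbering (G : SimpleGraph V) (w : V) (X : Finset V) (c : V → ℕ) : Prop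
    extends IsNumbering X c where
  two_le_card : 2 ≤ X.card
  dist_le : ∀ u ∈ X, G.dist w u + max (c u) 2 ≤ X.card + 1
  perimeter_le : ∀ u ∈ X, ∀ v ∈ X, u ≠ v → (perimeter G w u v + max (c u) 2 + max (c v) 2 : ℤ) ≤
    2 * X.card + 2 + max 1 |(max (c u) 2 - max (c v) 2 : ℤ)|
  exists_dist_le : 2 < X.card → ∃ u ∈ X, G.dist w u + max (c u) 2 ≤ X.card

theorem IsNumbering.exists_isNumbering_reverse {X : Finset V} [DecidableEq V] {w a b : V}
    {s : V → ℕ} (hs : IsNumbering (insert w (X \ {a, b})) s) (hsw : s w = 0) (hw : w ∉ X)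
    (ha : a ∈ X) (hb : b ∈ X) (hab : a ≠ b) :
    ∃ c, IsNumbering X c ∧ max (c a) 2 = 2 ∧ max (c b) 2 = 2 ∧
      ∀ z ∈ X \ {a, b}, s z + max (c z) 2 = X.card := by
  have mem_Z (z : V) : z ∈ X \ {a, b} ↔ z ∈ X ∧ z ≠ a ∧ z ≠ b := by simp
  have card_Z : (X \ {a, b}).card + 2 = X.card := by
    rw [← Finset.card_pair hab]
    exact Finset.card_sdiff_add_card_eq_card (by grind)
  have s_bounds (z : V) (hz : z ∈ X \ {a, b}) : 0 < s z ∧ s z + 1 < X.card := by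
    have hlt := hs.lt z (Finset.mem_insert_of_mem hz)
    rw [Finset.card_insert_of_notMem fun e => hw ((mem_Z w).1 e).1] at hlt
    refine ⟨Nat.pos_of_ne_zero fun h0 => ?_, by omega⟩
    have := hs.injOn (Finset.mem_insert_self w _) (Finset.mem_insert_of_mem hz) (hsw.trans h0.symm)
    exact hw (this ▸ ((mem_Z z).1 hz).1)
  have s_inj (u v : V) (hu : u ∈ X \ {a, b}) (hv : v ∈ X \ {a, b}) (huv : s u = s v) : u = v :=
    hs.injOn (Finset.mem_insert_of_mem hu) (Finset.mem_insert_of_mem hv) huv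
  refine ⟨fun u => if u = b then 0 else if u = a then 1 else X.card - s u, ⟨fun u hu => ?_,
    fun u hu v hv huv => ?_⟩, ?_, ?_, fun z hz => ?_⟩
  · grind
  · grind
  · grind
  · grind
  · grind

theorem IsNumbering.isKiteNumbering {X : Finset V} {w a b : V} {c : V → ℕ} (hc : IsNumbering X c)
    (ha : max (c a) 2 = 2) (hb : max (c b) 2 = 2) (hcard : 2 ≤ X.card)
    (hab : perimeter G w a b + 1 ≤ 2 * X.card)
    (hper : ∀ u ∈ X, ∀ v ∈ X, v ≠ a → v ≠ b →
      perimeter G w u v + 2 * min (max (c u) 2) (max (c v) 2) ≤ 2 * X.card + 2)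
    (hle : ∀ u ∈ X, G.dist w u + max (c u) 2 ≤ X.card + 1)
    (hex : 2 < X.card → ∃ u ∈ X, G.dist w u + max (c u) 2 ≤ X.card) :
    IsKiteNumbering G w X c := by
  refine ⟨hc, hcard, hle, fun u hu v hv huv => ?_, hex⟩
  wlog huv' : (u = a ∧ v = b) ∨ (v ≠ a ∧ v ≠ b) generalizing u v
  · have := this v hv u hu huv.symm (by grind)
    rw [perimeter_comm, abs_sub_comm]
    omega
  rcases huv' with ⟨rfl, rfl⟩ | ⟨hva, hvb⟩
  · omega
  · have := hper u hu v hv hva hvb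
    rw [Int.abs_eq_natAbs]
    omega

theorem perimeter_add_two_le_of_adj {S : Finset V} {w u v z : V} {s : V → ℕ} {N : ℕ}
    (hs : ∀ z ∈ S, s z + 2 ≤ N) (hper : ∀ u ∈ S, ∀ v ∈ S, perimeter G w u v ≤ 2 * max (s u) (s v))
    (hz : z ∈ S) (huz : G.Adj u z) (hv : v ∈ S) : perimeter G w u v + 2 ≤ 2 * N := by
  have := perimeter_le_perimeter_add_two huz w v
  have := hper z hz v hv
  have := hs z hz
  have := hs v hv
  omega

theorem exists_isKiteNumbering [DecidableEq V] {X : Finset V} {w a b : V} (f : V → ℕ) (hw : w ∉ X)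
    (ha : a ∈ X) (hb : b ∈ X) (hne : a ≠ b) (hab : perimeter G w a b + 1 ≤ 2 * X.card)
    (hf : ∀ u ∈ X, ∃ z ∈ insert w (X \ {a, b}), G.Adj u z ∧ f z < f u) :
    ∃ c, IsKiteNumbering G w X c := by
  obtain ⟨s, hs, hsw, hper⟩ := exists_isNumbering_perimeter_le f (Finset.mem_insert_self w _)
    fun u hu huw => hf u (by grind)
  obtain ⟨c, hc, hca, hcb, hcz⟩ := hs.exists_isNumbering_reverse hsw hw ha hb hne
  have card_Z : (X \ {a, b}).card + 2 = X.card := by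
    rw [← Finset.card_pair hne]
    exact Finset.card_sdiff_add_card_eq_card (by grind)
  have s_add_two_le (z : V) (hz : z ∈ insert w (X \ {a, b})) : s z + 2 ≤ X.card := by
    rcases Finset.mem_insert.1 hz with rfl | hz
    · omega
    · have := hcz z hz
      omega
  have perimeter_le {u v : V} (hu : u ∈ X) (hv : v ∈ insert w (X \ {a, b})) :
      perimeter G w u v + 2 ≤ 2 * X.card := by
    obtain ⟨z, hz, huz, -⟩ := hf u hu
    exact perimeter_add_two_le_of_adj s_add_two_le hper hz huz hv
  have eq_two_or (u : V) (hu : u ∈ X) : max (c u) 2 = 2 ∨ u ∈ X \ {a, b} := by grind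
  have dist_le (z : V) (hz : z ∈ X \ {a, b}) : G.dist w z + max (c z) 2 ≤ X.card := by
    have := hper z (Finset.mem_insert_of_mem hz) z (Finset.mem_insert_of_mem hz)
    have := hcz z hz
    rw [perimeter_self] at *
    omega
  refine ⟨c, hc.isKiteNumbering hca hcb (by omega) hab (fun u hu v hv hva hvb => ?_)
    (fun u hu => ?_) fun hcard => ?_⟩
  · have hvZ : v ∈ insert w (X \ {a, b}) := by simp [hv, hva, hvb]
    rcases eq_two_or u hu with hcu | huZ
    · have := perimeter_le hu hvZ
      omega
    · have := hper u (Finset.mem_insert_of_mem huZ) v hvZ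
      have := hcz u huZ
      have := hcz v (by simp [hv, hva, hvb])
      omega
  · rcases eq_two_or u hu with hcu | huZ
    · have := perimeter_le hu (Finset.mem_insert_self w _)
      rw [perimeter, SimpleGraph.dist_self, G.dist_comm (u := u) (v := w)] at this
      omega
    · exact (dist_le u huZ).trans (Nat.le_succ _)
  · obtain ⟨z, hz⟩ := Finset.card_pos.1 (show 0 < (X \ {a, b}).card by omega)
    exact ⟨z, Finset.sdiff_subset hz, dist_le z hz⟩

end KiteNumbering

section CycleKiteNumbering

variable {V : Type*} {G : SimpleGraph V} {ℓ : ℕ} {r : ℕ → V} {γ : V → V}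

namespace GatedCycle

theorem exists_deepest [Finite V] (h : GatedCycle G ℓ r γ) (j : ℕ) :
    ∃ a, γ a = r j ∧ ∀ u, γ u = γ a → G.dist (γ a) u ≤ G.dist (γ a) a := by
  obtain ⟨a, ha, hmax⟩ := Set.exists_max_image {u | γ u = r j} (fun u => G.dist (r j) u)
    (Set.toFinite _) ⟨r j, h.gate_self j⟩
  exact ⟨a, ha, fun u hu => ha.symm ▸ hmax u (hu.trans ha)⟩

theorem exists_adj_height_lt {k : ℕ} (h : GatedCycle G (k + 3) r γ) (hG : G.Preconnected)
    {a b u : V} (ha : γ a = r (k + 2)) (hb : γ b = r (k + 1))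
    (ha_max : ∀ u, γ u = γ a → G.dist (γ a) u ≤ G.dist (γ a) a)
    (hb_max : ∀ u, γ u = γ b → G.dist (γ b) u ≤ G.dist (γ b) b) (hu : γ u ≠ r 0) :
    ∃ z, (z = r 0 ∨ γ z ≠ r 0 ∧ z ≠ a ∧ z ≠ b) ∧ G.Adj u z ∧
      gateIndex r γ z + G.dist (γ z) z < gateIndex r γ u + G.dist (γ u) u := by
  by_cases hγ : γ u = u
  · have hju := h.apply_gateIndex u
    obtain ⟨j, hj⟩ := Nat.exists_eq_succ_of_ne_zero fun e : gateIndex r γ u = 0 =>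
      hu (by rw [← hju, e])
    have j_lt := hj ▸ h.gateIndex_lt u
    rw [hγ, hj] at hju
    rw [hγ, hj, SimpleGraph.dist_self]
    by_cases hjk : j = k + 1
    · refine ⟨r 0, Or.inl rfl, ?_, ?_⟩
      · rw [← hju, hjk, show r 0 = r (k + 3) by simpa using (h.add_mul 0 1).symm]
        exact h.adj (k + 2)
      · rw [h.gateIndex_apply h.pos, h.gate_self, SimpleGraph.dist_self]
        omega
    · refine ⟨r j, or_iff_not_imp_left.2 fun hj₀ => ⟨?_, ?_, ?_⟩, hju ▸ (h.adj j).symm, ?_⟩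
      · rwa [h.gate_self]
      · exact fun e => absurd (h.injOn (Set.mem_Iio.2 (by omega)) (Set.mem_Iio.2 (by omega))
          ((h.gate_self j).symm.trans (e ▸ ha))) (by omega)
      · exact fun e => absurd (h.injOn (Set.mem_Iio.2 (by omega)) (Set.mem_Iio.2 (by omega))
          ((h.gate_self j).symm.trans (e ▸ hb))) (by omega)
      · rw [h.gateIndex_apply (by omega), h.gate_self, SimpleGraph.dist_self]
        omega
  · obtain ⟨z, hadj, hγz, hlt⟩ := h.exists_parent hG hγ
    refine ⟨z, Or.inr ⟨hγz ▸ hu, ?_, ?_⟩, hadj, ?_⟩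
    · rintro rfl
      exact (ha_max u hγz.symm).not_gt (hγz ▸ hlt)
    · rintro rfl
      exact (hb_max u hγz.symm).not_gt (hγz ▸ hlt)
    · rw [gateIndex_congr hγz, hγz]
      omega

variable [Fintype V] [DecidableEq V]

theorem dist_lt_card_pile (h : GatedCycle G ℓ r γ) (hG : G.Preconnected) {w a : V} (hw : γ w = w)
    (ha : γ a = w) : G.dist w a < (Finset.univ.filter fun u => γ u = w).card := by
  obtain ⟨p, hp⟩ := (h.pile_preconnected hG hw ⟨w, hw⟩ ⟨a, ha⟩).exists_isPath
  rw [← Fintype.card_subtype]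
  refine lt_of_le_of_lt ?_ hp.length_lt
  rw [← SimpleGraph.Walk.length_map (SimpleGraph.Embedding.induce _).toHom]
  exact SimpleGraph.dist_le _

theorem card_gate_ne (h : GatedCycle G ℓ r γ) :
    (Finset.univ.filter fun u => γ u ≠ r 0).card =
      ∑ j ∈ Finset.Ico 1 ℓ, (Finset.univ.filter fun u => γ u = r j).card := by
  rw [Finset.card_eq_sum_card_fiberwise (f := gateIndex r γ) (t := Finset.Ico 1 ℓ)]
  · refine Finset.sum_congr rfl fun j hj => congrArg Finset.card (Finset.ext fun u => ?_)
    rw [Finset.mem_Ico] at hj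
    have := h.gateIndex_eq_iff (u := u) hj.2
    have := h.gateIndex_eq_iff (u := u) h.pos
    simp only [Finset.mem_filter, Finset.mem_univ, true_and]
    grind
  · intro u hu
    have := h.gateIndex_lt u
    have := h.gateIndex_eq_iff (u := u) h.pos
    simp only [Finset.coe_filter, Finset.mem_univ, true_and, Set.mem_ofPred_eq] at hu
    simp only [Finset.coe_Ico, Set.mem_Ico]
    grind

theorem perimeter_add_one_le {k : ℕ} (h : GatedCycle G (k + 3) r γ) (hG : G.Connected) {a b : V}
    (ha : γ a = r (k + 2)) (hb : γ b = r (k + 1)) :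
    perimeter G (r 0) a b + 1 ≤ 2 * (Finset.univ.filter fun u => γ u ≠ r 0).card := by
  have pile_pos (j : ℕ) : 0 < (Finset.univ.filter fun u => γ u = r j).card :=
    Finset.card_pos.2 ⟨r j, by simp [h.gate_self]⟩
  have card_le := Finset.sum_le_sum fun j (_ : j ∈ Finset.Ico 1 (k + 1)) =>
    Nat.succ_le_of_lt (pile_pos j)
  have card_eq := h.card_gate_ne
  rw [Finset.sum_Ico_succ_top (by omega), Finset.sum_Ico_succ_top (by omega)] at card_eq
  simp only [Nat.succ_eq_add_one, zero_add, Finset.sum_const, Nat.card_Ico, smul_eq_mul,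
    mul_one] at card_le
  have dist_a := h.dist_lt_card_pile hG.preconnected (h.gate_self _) ha
  have dist_b := h.dist_lt_card_pile hG.preconnected (h.gate_self _) hb
  have dist_gates : G.dist (r (k + 1)) (r (k + 2)) ≤ 1 := h.dist_add_le (k + 1) 1
  have dist_gate_b := h.dist_add_le 0 (k + 1)
  have dist_gate_a := h.dist_add_le (k + 2) 1
  rw [show r (k + 2 + 1) = r 0 by simpa using h.add_mul 0 1] at dist_gate_a
  rw [zero_add] at dist_gate_b
  have := hG.dist_triangle (u := r 0) (v := r (k + 2)) (w := a)
  have := hG.dist_triangle (u := r 0) (v := r (k + 1)) (w := b)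
  have := hG.dist_triangle (u := a) (v := r (k + 2)) (w := b)
  have := hG.dist_triangle (u := r (k + 2)) (v := r (k + 1)) (w := b)
  rw [G.dist_comm] at dist_gates dist_gate_a
  rw [perimeter]
  have := G.dist_comm (u := a) (v := r (k + 2))
  omega

theorem exists_isKiteNumbering (h : GatedCycle G ℓ r γ) (hG : G.Connected) {w : V}
    (hw : γ w = w) : ∃ c, IsKiteNumbering G w (Finset.univ.filter fun u => γ u ≠ w) c := by
  wlog hr : r 0 = w generalizing r
  · obtain ⟨j, hj⟩ := h.gate_mem w
    exact this (h.rotate j) (by simpa [hw] using hj)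
  subst hr
  obtain ⟨k, rfl⟩ := Nat.exists_eq_add_of_le' h.three_le
  obtain ⟨a, ha, ha_max⟩ := h.exists_deepest (k + 2)
  obtain ⟨b, hb, hb_max⟩ := h.exists_deepest (k + 1)
  have ne {i j : ℕ} (hij : i < j) (hj : j < k + 3) : r j ≠ r i := fun e =>
    hij.ne' (h.injOn hj (hij.trans hj) e)
  refine DistSpec.exists_isKiteNumbering (a := a) (b := b)
    (fun u => gateIndex r γ u + G.dist (γ u) u) (by simp [hw]) ?_ ?_ ?_
    (h.perimeter_add_one_le hG ha hb) fun u hu => ?_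
  · simpa [ha] using ne (by omega) (by omega)
  · simpa [hb] using ne (by omega) (by omega)
  · rintro rfl
    exact ne (Nat.lt_succ_self _) (by omega) (ha.symm.trans hb)
  · obtain ⟨z, hz, hadj, hlt⟩ := h.exists_adj_height_lt hG.preconnected ha hb ha_max hb_max
      (Finset.mem_filter.1 hu).2
    exact ⟨z, by simpa using hz, hadj, hlt⟩

end GatedCycle

end CycleKiteNumbering

section Glue

variable {V : Type*}

theorem sum_sum_mul_add (s t : Finset V) (y a b : V → ℝ) :
    ∑ u ∈ s, ∑ v ∈ t, y u * y v * (a u + b v) =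
      (∑ u ∈ s, y u * a u) * ∑ v ∈ t, y v + (∑ u ∈ s, y u) * ∑ v ∈ t, y v * b v := by
  rw [Finset.sum_mul_sum, Finset.sum_mul_sum, ← Finset.sum_add_distrib]
  refine Finset.sum_congr rfl fun u _ => ?_
  rw [← Finset.sum_add_distrib]
  exact Finset.sum_congr rfl fun v _ => by ring

variable [DecidableEq V]

/-- The kernel that is `k` outside `X`, costs a slack `σ` for each argument inside `X`, and between
`X` and its complement regains that slack. -/
def glueKernel (X : Finset V) (σ κ : V → ℝ) (k : V → V → ℝ) (u v : V) : ℝ :=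
  if u ∈ X then if v ∈ X then -(σ u + σ v) else σ u + κ v - 1
  else if v ∈ X then σ v + κ u - 1 else k u v

theorem kerForm_glueKernel [Fintype V] (X : Finset V) (σ κ : V → ℝ) (k : V → V → ℝ) (x : V → ℝ) :
    kerForm Finset.univ (glueKernel X σ κ k) x =
      2 * ((∑ u ∈ X, x u * σ u) * (∑ q ∈ Xᶜ, x q - ∑ u ∈ X, x u)) +
        (kerForm Xᶜ k x - 2 * ((∑ u ∈ X, x u) * ∑ q ∈ Xᶜ, x q * (1 - κ q))) := by
  have split (f : V → V → ℝ) : ∑ u, ∑ v, f u v = ∑ u ∈ X, ∑ v ∈ X, f u v +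
      ∑ u ∈ X, ∑ v ∈ Xᶜ, f u v + (∑ u ∈ X, ∑ v ∈ Xᶜ, f v u + ∑ u ∈ Xᶜ, ∑ v ∈ Xᶜ, f u v) := by
    simp only [← Finset.sum_add_sum_compl X, Finset.sum_add_distrib]
    rw [Finset.sum_comm (s := Xᶜ) (t := X)]
  have inner : ∑ u ∈ X, ∑ v ∈ X, x u * x v * glueKernel X σ κ k u v =
      ∑ u ∈ X, ∑ v ∈ X, x u * x v * (-σ u + -σ v) :=
    Finset.sum_congr rfl fun u hu => Finset.sum_congr rfl fun v hv => by
      rw [glueKernel, if_pos hu, if_pos hv, neg_add]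
  have cross : ∑ u ∈ X, ∑ v ∈ Xᶜ, x u * x v * glueKernel X σ κ k u v =
      ∑ u ∈ X, ∑ v ∈ Xᶜ, x u * x v * (σ u + -(1 - κ v)) :=
    Finset.sum_congr rfl fun u hu => Finset.sum_congr rfl fun v hv => by
      rw [glueKernel, if_pos hu, if_neg (Finset.mem_compl.1 hv), neg_sub, add_sub_assoc]
  have cross' : ∑ u ∈ X, ∑ v ∈ Xᶜ, x v * x u * glueKernel X σ κ k v u =
      ∑ u ∈ X, ∑ v ∈ Xᶜ, x u * x v * (σ u + -(1 - κ v)) :=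
    Finset.sum_congr rfl fun u hu => Finset.sum_congr rfl fun v hv => by
      rw [glueKernel, if_neg (Finset.mem_compl.1 hv), if_pos hu, neg_sub, add_sub_assoc,
        mul_comm (x v)]
  have outer : ∑ u ∈ Xᶜ, ∑ v ∈ Xᶜ, x u * x v * glueKernel X σ κ k u v = kerForm Xᶜ k x :=
    Finset.sum_congr rfl fun u hu => Finset.sum_congr rfl fun v hv => by
      rw [glueKernel, if_neg (Finset.mem_compl.1 hu), if_neg (Finset.mem_compl.1 hv)]
  rw [kerForm, split, inner, cross, cross', outer, sum_sum_mul_add, sum_sum_mul_add]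
  simp only [mul_neg, Finset.sum_neg_distrib]
  ring

end Glue

section Kite

variable {k n : ℕ}

theorem kite_connected (hn : 0 < n) : (kite k n).Connected := by
  have : Nonempty (Fin n) := ⟨⟨0, hn⟩⟩
  have reach := reachable_of_forall_exists_adj_lt (G := kite k n) (r := ⟨0, hn⟩) Fin.val
    fun z hz => by
      have hz₀ : z.val ≠ 0 := fun e => hz (Fin.ext e)
      refine ⟨⟨z - 1, by omega⟩, ⟨fun e => ?_, Or.inr (Or.inr (Nat.sub_add_cancel
        (Nat.pos_of_ne_zero hz₀)))⟩, Nat.sub_one_lt hz₀⟩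
      have := congrArg Fin.val e
      simp only at this
      omega
  exact ⟨fun u v => (reach u).trans (reach v).symm⟩

theorem max_le_max_add_dist_kite (i j : Fin n) :
    max i.val (k - 2) ≤ max j.val (k - 2) + (kite k n).dist i j := by
  rw [SimpleGraph.dist_comm]
  refine le_add_dist_of_forall_adj (kite_connected (Fin.pos i)) (fun i => max i.val (k - 2))
    (fun u v huv => ?_) j i
  have := huv.2
  omega

end Kite

section Comparison

variable {V : Type*} {G : SimpleGraph V} {X : Finset V} {w : V} {c t : V → ℕ}

/-- How far the distance from `w` to `u` stays below what the position `c u` at the clique end of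
the kite `K₄⁽ⁿ⁾` admits. -/
noncomputable def kiteSlack (G : SimpleGraph V) (w : V) (X : Finset V) (c : V → ℕ) (u : V) : ℝ :=
  X.card + 1 - (G.dist w u + max (c u) 2 : ℕ)

theorem IsKiteNumbering.kiteSlack_nonneg (hc : IsKiteNumbering G w X c) {u : V} (hu : u ∈ X) :
    0 ≤ kiteSlack G w X c u :=
  sub_nonneg.2 (by exact_mod_cast hc.dist_le u hu)

theorem IsKiteNumbering.neg_kiteSlack_add_le (hc : IsKiteNumbering G w X c) {u v : V} (hu : u ∈ X)
    (hv : v ∈ X) (hne : u ≠ v) : -(kiteSlack G w X c u + kiteSlack G w X c v) ≤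
      (max 1 |(max (c u) 2 - max (c v) 2 : ℤ)| : ℤ) - G.dist u v := by
  have perimeter_le := hc.perimeter_le u hu v hv hne
  rw [perimeter] at perimeter_le
  generalize max 1 |(max (c u) 2 - max (c v) 2 : ℤ)| = m at perimeter_le ⊢
  rw [kiteSlack, kiteSlack]
  rify at perimeter_le
  push_cast at perimeter_le ⊢
  linarith

variable [DecidableEq V]

theorem glueKernel_comm {σ κ : V → ℝ} {k : V → V → ℝ} (hk : ∀ u v, k u v = k v u) (u v : V) :
    glueKernel X σ κ k u v = glueKernel X σ κ k v u := by
  simp only [glueKernel, hk u v, add_comm (σ u) (σ v)]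
  split_ifs <;> rfl

variable [Fintype V]

theorem IsNumbering.exists_equiv_fin (hc : IsNumbering X c) (ht : IsNumbering Xᶜ t) :
    ∃ e : V ≃ Fin (Fintype.card V), (∀ u ∈ X, (e u : ℕ) = c u) ∧
      ∀ u ∉ X, (e u : ℕ) = X.card + t u := by
  have card_eq := X.card_add_card_compl
  have c_lt := hc.lt
  have t_lt := ht.lt
  simp only [Finset.mem_compl] at t_lt
  have pos_lt (u : V) : (if u ∈ X then c u else X.card + t u) < Fintype.card V := by grind
  have inj : Function.Injective fun u => (⟨_, pos_lt u⟩ : Fin (Fintype.card V)) := by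
    intro u v huv
    have c_inj := @hc.injOn u
    have t_inj := @ht.injOn u
    simp only [Finset.coe_compl, Set.mem_compl_iff, Finset.mem_coe] at c_inj t_inj
    rw [Fin.mk.injEq] at huv
    grind
  refine ⟨Equiv.ofBijective _ ((Fintype.bijective_iff_injective_and_card _).2
    ⟨inj, (Fintype.card_fin _).symm⟩), fun u hu => ?_, fun u hu => ?_⟩ <;> simp [hu]

theorem IsKiteNumbering.glueKernel_le (hc : IsKiteNumbering G w X c) (hG : G.Connected)
    {e : V ≃ Fin (Fintype.card V)} (hX : ∀ u ∈ X, (e u : ℕ) = c u)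
    (hQ : ∀ u ∉ X, (e u : ℕ) = X.card + t u) (u v : V) :
    glueKernel X (kiteSlack G w X c) (fun q => t q - G.dist w q)
      (fun u v => |(t u : ℝ) - t v| - G.dist u v) u v ≤
      (kite 4 (Fintype.card V)).dist (e u) (e v) - G.dist u v := by
  wlog huv : v ∈ X → u ∈ X generalizing u v
  · rw [glueKernel_comm (fun a b => by rw [abs_sub_comm, G.dist_comm]), G.dist_comm,
      SimpleGraph.dist_comm]
    exact this v u (by tauto)
  have two_le_card := hc.two_le_card
  have le_dist := max_le_max_add_dist_kite (k := 4) (e u) (e v)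
  have ge_dist := max_le_max_add_dist_kite (k := 4) (e v) (e u)
  rw [SimpleGraph.dist_comm] at ge_dist
  by_cases hu : u ∈ X <;> by_cases hv : v ∈ X
  · rcases eq_or_ne u v with rfl | hne
    · rw [glueKernel, if_pos hu, if_pos hu, SimpleGraph.dist_self, SimpleGraph.dist_self]
      linarith [hc.kiteSlack_nonneg hu]
    rw [glueKernel, if_pos hu, if_pos hv]
    refine (hc.neg_kiteSlack_add_le hu hv hne).trans (sub_le_sub_right ?_ _)
    rw [hX u hu, hX v hv] at le_dist ge_dist
    have one_le := (kite_connected (k := 4) (Fin.pos (e u))).pos_dist_of_ne (e.injective.ne hne)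
    exact_mod_cast (max_le (by omega) (abs_le.2 (by omega)) :
      max 1 |(max (c u) 2 - max (c v) 2 : ℤ)| ≤ (kite 4 (Fintype.card V)).dist (e u) (e v))
  · rw [glueKernel, if_pos hu, if_neg hv, kiteSlack]
    rw [hX u hu, hQ v hv, max_eq_left (by omega)] at ge_dist
    have triangle := hG.dist_triangle (u := u) (v := w) (w := v)
    rw [G.dist_comm (u := u) (v := w)] at triangle
    rify at ge_dist triangle
    push_cast at ge_dist ⊢
    norm_num at ge_dist
    linarith
  · exact absurd (huv hv) hu
  · rw [glueKernel, if_neg hu, if_neg hv]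
    rw [hQ u hu, hQ v hv, max_eq_left (by omega), max_eq_left (by omega)] at le_dist ge_dist
    refine sub_le_sub_right (abs_le.2 ⟨?_, ?_⟩) _ <;> rify at le_dist ge_dist <;> linarith

theorem IsKiteNumbering.exists_glueKernel_lt (hc : IsKiteNumbering G w X c) (hG : G.Connected)
    (hw : w ∉ X) (ht : IsNumbering Xᶜ t) {e : V ≃ Fin (Fintype.card V)} : ∃ u v,
    glueKernel X (kiteSlack G w X c) (fun q => t q - G.dist w q)
      (fun u v => |(t u : ℝ) - t v| - G.dist u v) u v <
      (kite 4 (Fintype.card V)).dist (e u) (e v) - G.dist u v := by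
  rcases hc.two_le_card.eq_or_lt with card_eq | two_lt
  · obtain ⟨u, hu⟩ := Finset.card_pos.1 (zero_lt_two.trans_le hc.two_le_card)
    obtain ⟨q, hq, tq⟩ := ht.exists_eq (Finset.card_pos.2 ⟨w, Finset.mem_compl.2 hw⟩)
    rw [Finset.mem_compl] at hq
    refine ⟨u, q, ?_⟩
    have one_le := (kite_connected (k := 4) (Fin.pos (e u))).pos_dist_of_ne
      (e.injective.ne (ne_of_mem_of_not_mem hu hq))
    have triangle := hG.dist_triangle (u := u) (v := w) (w := q)
    rw [G.dist_comm (u := u) (v := w)] at triangle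
    have two_le : 2 ≤ max (c u) 2 := le_max_right _ _
    rw [glueKernel, if_pos hu, if_neg hq, kiteSlack, ← card_eq, tq]
    rify at triangle two_le one_le
    push_cast at two_le ⊢
    linarith
  · obtain ⟨u, hu, hle⟩ := hc.exists_dist_le two_lt
    refine ⟨u, u, ?_⟩
    have slack_pos : 0 < kiteSlack G w X c u := sub_pos.2 (by exact_mod_cast Nat.lt_succ_of_le hle)
    rw [glueKernel, if_pos hu, if_pos hu, SimpleGraph.dist_self, SimpleGraph.dist_self]
    linarith

end Comparison

section Assembly

variable {V : Type*} [Fintype V] {G : SimpleGraph V} {x : V → ℝ}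

theorem distForm_comp_symm {W : Type*} [Fintype W] (K : SimpleGraph W) (e : V ≃ W) (x : V → ℝ) :
    distForm K (x ∘ e.symm) = kerForm Finset.univ (fun u v => (K.dist (e u) (e v) : ℝ)) x := by
  simp only [distForm, kerForm, ← e.sum_comp, Function.comp_apply, e.symm_apply_apply]

theorem distForm_anti {G₀ : SimpleGraph V} (hle : G₀ ≤ G) (hG₀ : G₀.Connected)
    (hx : ∀ v, 0 ≤ x v) : distForm G x ≤ distForm G₀ x :=
  kerForm_mono (fun v _ => hx v) fun u _ v _ => by exact_mod_cast (hG₀ u v).dist_anti hle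

theorem IsKiteNumbering.exists_distForm_lt_kite [DecidableEq V] {X : Finset V} {w : V} {c t : V → ℕ}
    (hc : IsKiteNumbering G w X c) (hG : G.Connected) (hw : w ∉ X) (ht : IsNumbering Xᶜ t)
    (hx : ∀ v, 0 < x v) (hX : ∑ u ∈ X, x u ≤ ∑ q ∈ Xᶜ, x q)
    (hpile : 2 * ((∑ u ∈ X, x u) * ∑ q ∈ Xᶜ, x q * (1 - (t q - G.dist w q))) ≤
      kerForm Xᶜ (fun u v => |(t u : ℝ) - t v| - G.dist u v) x) :
    ∃ e : V ≃ Fin (Fintype.card V),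
      distForm G x < distForm (kite 4 (Fintype.card V)) (x ∘ e.symm) := by
  obtain ⟨e, heX, heQ⟩ := hc.toIsNumbering.exists_equiv_fin ht
  obtain ⟨u, v, hlt⟩ := hc.exists_glueKernel_lt hG hw ht (e := e)
  have gain_nonneg : 0 ≤ kerForm Finset.univ (glueKernel X (kiteSlack G w X c)
      (fun q => t q - G.dist w q) fun u v => |(t u : ℝ) - t v| - G.dist u v) x := by
    rw [kerForm_glueKernel]
    exact add_nonneg (mul_nonneg zero_le_two (mul_nonneg (Finset.sum_nonneg fun u hu =>
      mul_nonneg (hx u).le (hc.kiteSlack_nonneg hu)) (sub_nonneg.2 hX))) (sub_nonneg.2 hpile)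
  have gain_lt := kerForm_lt_kerForm (fun v _ => hx v)
    (fun u _ v _ => hc.glueKernel_le hG heX heQ u v)
    ⟨u, Finset.mem_univ u, v, Finset.mem_univ v, hlt⟩
  rw [kerForm_sub, ← distForm_comp_symm] at gain_lt
  exact ⟨e, sub_pos.1 (gain_nonneg.trans_lt gain_lt)⟩

theorem GatedFamily.exists_distForm_lt_kite {ι : Type*} [Fintype ι] {ℓ : ι → ℕ} {r : ι → ℕ → V}
    {γ : ι → V → V} (hι : 3 ≤ Fintype.card ι) (h : GatedFamily G ℓ r γ) (hG : G.Connected)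
    (hx : ∀ v, 0 < x v) :
    ∃ e : V ≃ Fin (Fintype.card V),
      distForm G x < distForm (kite 4 (Fintype.card V)) (x ∘ e.symm) := by
  classical
  have : Nontrivial ι := Fintype.one_lt_card_iff_nontrivial.1 (by omega)
  obtain ⟨i, w, hw, hend, hmin⟩ := h.exists_end_cycle hG.preconnected hx
  obtain ⟨c, hc⟩ := (h.gated i).exists_isKiteNumbering hG hw
  obtain ⟨t, ht, hpile⟩ := h.exists_isNumbering_pile hι hG (fun v => (hx v).le) hw hend
    (Finset.sum_nonneg fun u _ => (hx u).le) hmin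
  have compl_eq : (Finset.univ.filter fun u => γ i u ≠ w)ᶜ =
      Finset.univ.filter fun u => γ i u = w := by
    simp only [Finset.compl_filter, not_not]
  obtain ⟨k, hk⟩ := exists_ne i
  obtain ⟨a, ha⟩ := (h.gated i).gate_mem w
  refine hc.exists_distForm_lt_kite hG (by simp [hw]) (compl_eq ▸ ht) hx ?_ (compl_eq ▸ hpile)
  rw [compl_eq]
  refine (hmin k hk).trans (Finset.sum_le_sum_of_subset_of_nonneg
    (Finset.monotone_filter_right _ fun u _ hu => ?_) fun u _ _ => (hx u).le)
  rw [← hend k hk 0]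
  refine h.gate_eq_of_gate_ne hG.preconnected hk.symm ?_
  rwa [← h.gate_eq k i hk a, ha, hw]

end Assembly

end DistSpec

theorem mainTheorem6 {V : Type*} [Fintype V] [DecidableEq V] (G : SimpleGraph V) (n : ℕ)
    (hn : Fintype.card V = n) (hG : G.Connected)
    (hC : ∃ G₁ G₂ G₃ : G.Subgraph, DistSpec.AreCactusTypeCycles G₁ G₂ G₃) :
    DistSpec.distSpectralRadius G < DistSpec.distSpectralRadius (DistSpec.kite 4 n) := by
  subst hn
  obtain ⟨G₁, G₂, G₃, hC⟩ := hC
  obtain ⟨G₀, hle, hG₀, ℓ, r, γ, h⟩ := hC.exists_gatedFamily hG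
  refine DistSpec.distSpectralRadius_lt_of_distForm_lt hG _ fun x hx => ?_
  obtain ⟨e, he⟩ := h.exists_distForm_lt_kite (Fintype.card_fin 3).ge hG₀ hx
  exact ⟨e, (DistSpec.distForm_anti hle hG₀ fun v => (hx v).le).trans_lt he⟩
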